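/- Theorem (ML-duality for skew matrices). Let $m$ be a positive integer, let $r\in\{2,\dots,m\}$ be even, and let $s$ be the largest even integer with $s\le m-r$. Let $S$ be the skew $m\times m$ matrix with all entries above the diagonal equal to $1$, and put $$\mathcal{AM}_r=\Big\{P\in\mathbb C^{m\times m}\ \Big|\ P \text{ skew},\ \sum_{i<j}p_{ij}=1,\ \operatorname{rk}P=r,\ p_{ij}\ne 0 \text{ for all } i<j\Big\},$$ $$\mathcal{AM}'_s=\big\{P\in\mathbb C^{m\times m}\ \big|\ P\text{ skew},\ p_{ij}\neq 0\text{ for all }i<j,\ \operatorname{rk}(S-P)=s\big\}.$$ A data matrix is a symmetric matrix $U\in\mathbb C^{m\times m}$ with zero diagonal; a property holds for sufficiently general $U$ if it holds on a nonempty Zariski-open subset of the linear space of data matrices. Write $U_{++}=\sum_{i,j}u_{ij}$ and $\ell_U(P)=\prod_{i<j}p_{ij}^{u_{ij}}$ (multivalued if the $u_{ij}$ are not integers). For $X$ one of the above varieties, a point $P\in X$ is a critical point of $\ell_U$ on $X$ if the logarithmic derivative $\sum_{i<j}v_{ij}u_{ij}/p_{ij}$ vanishes for all $V=(v_{ij})$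 in the Zariski tangent space $T_PX$. The ML-degree of $X$ is the number of critical points of $\ell_U$ on $X$ for sufficiently general $U$. Then for sufficiently general $U$ one has $U_{++}\ne0$ and the following hold. 1. For each critical point $P$ of $\ell_U$ on $\mathcal{AM}_r$ there is exactly one skew matrix $Q$ with entrywise product $P*Q=U$, namely the one with $q_{ij}=u_{ij}/p_{ij}$ for $i\ne j$; and $Q':=2Q/U_{++}$ is a critical point of $\ell_U$ on $\mathcal{AM}'_s$. 2. The map $P\mapsto Q'$ is a bijection from the critical points of $\ell_U$ on $\mathcal{AM}_r$ to those on $\mathcal{AM}'_s$, and its inverse is given by the same formula. 3. The product $\ell_U(P)\,\ell_U(Q')$ is the same for all critical points $P$ of $\ell_U$ on $\mathcal{AM}_r$. (If $U$ has entries in $\mathbb N$, this is an equality of complex numbers; for general complex $U$, the set of all products of a value of $\ell_U(P)$ and a value of $\ell_U(Q')$ does not depend on $P$.) In particular, the ML-degrees of $\mathcal{AM}_r$ and $\mathcal{AM}'_s$ exist (as natural numbers) and coincide. -/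

import Mathlib

open scoped Matrix Pointwise

namespace MLDuality

/-- The data matrices: complex symmetric `m × m` matrices with zeroes on the diagonal. -/
def dataMatrices (m : ℕ) : Set (Matrix (Fin m) (Fin m) ℂ) :=
  {U | Uᵀ = U ∧ ∀ i, U i i = 0}

/-- The sum of the entries strictly above the diagonal. -/
def upperSum {m : ℕ} (P : Matrix (Fin m) (Fin m) ℂ) : ℂ :=
  ∑ i, ∑ j ∈ Finset.Ioi i, P i j

/-- `U₊₊`, the sum of all entries of a matrix. -/
def totalSum {m : ℕ} (U : Matrix (Fin m) (Fin m) ℂ) : ℂ :=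
  ∑ i, ∑ j, U i j

/-- The value of a polynomial in `m × m` variables at a matrix. -/
noncomputable def evalMatrix {m : ℕ} (P : Matrix (Fin m) (Fin m) ℂ)
    (f : MvPolynomial (Fin m × Fin m) ℂ) : ℂ :=
  MvPolynomial.eval (fun p : Fin m × Fin m => P p.1 p.2) f

/-- A property holds for all sufficiently general data matrices: it holds on a nonempty
Zariski-open subset of the linear space of data matrices. -/
def ForGeneralData (m : ℕ) (p : Matrix (Fin m) (Fin m) ℂ → Prop) : Prop :=
  ∃ f : MvPolynomial (Fin m × Fin m) ℂ,
    (∃ U ∈ dataMatrices m, evalMatrix U f ≠ 0) ∧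
      ∀ U ∈ dataMatrices m, evalMatrix U f ≠ 0 → p U

/-- The Zariski tangent space at `P` of a (locally closed) subvariety `X` of the space of
`m × m` matrices: the vectors `V` that are killed by the differential at `P` of every
polynomial that vanishes on `X`. -/
def tangentSpace {m : ℕ} (X : Set (Matrix (Fin m) (Fin m) ℂ))
    (P : Matrix (Fin m) (Fin m) ℂ) : Set (Matrix (Fin m) (Fin m) ℂ) :=
  {V | ∀ f : MvPolynomial (Fin m × Fin m) ℂ, (∀ Y ∈ X, evalMatrix Y f = 0) →
    ∑ i, ∑ j, V i j * evalMatrix P (MvPolynomial.pderiv (i, j) f) = 0}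

/-- The critical points on `X` of `ℓ_U(P) = ∏_{i<j} p_{ij} ^ u_{ij}`. For complex exponents this
function is multivalued, but its logarithmic derivative at `P` in the direction `V`,
which is `∑_{i<j} v_{ij} u_{ij} / p_{ij}`, is not. -/
def criticalPoints {m : ℕ} (U : Matrix (Fin m) (Fin m) ℂ)
    (X : Set (Matrix (Fin m) (Fin m) ℂ)) : Set (Matrix (Fin m) (Fin m) ℂ) :=
  {P | P ∈ X ∧ ∀ V ∈ tangentSpace X P, ∑ i, ∑ j ∈ Finset.Ioi i, V i j * U i j / P i j = 0}

/-- `d` is the ML-degree of `X`: the number of critical points of `ℓ_U` on `X` for every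
sufficiently general data matrix `U`. -/
def IsMLDegree {m : ℕ} (X : Set (Matrix (Fin m) (Fin m) ℂ)) (d : ℕ) : Prop :=
  ForGeneralData m fun U => (criticalPoints U X).encard = d

/-- The variety of skew `m × m` matrices of rank `r` whose entries above the diagonal are nonzero
and add up to one. -/
def AM (m r : ℕ) : Set (Matrix (Fin m) (Fin m) ℂ) :=
  {P | Pᵀ = -P ∧ upperSum P = 1 ∧ P.rank = r ∧ ∀ i j, i < j → P i j ≠ 0}

/-- The skew matrix with all entries above the diagonal equal to one. -/
def skewOnes (m : ℕ) : Matrix (Fin m) (Fin m) ℂ :=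
  Matrix.of fun i j => if i < j then 1 else if j < i then -1 else 0

/-- The variety of skew `m × m` matrices `P` whose entries above the diagonal are nonzero and for
which `S - P` has rank `s`, where `S` is the matrix `skewOnes m`. -/
def AM' (m s : ℕ) : Set (Matrix (Fin m) (Fin m) ℂ) :=
  {P | Pᵀ = -P ∧ (∀ i j, i < j → P i j ≠ 0) ∧ (skewOnes m - P).rank = s}

/-- The entrywise quotient `U / P`, with the convention `0 / 0 = 0` on the diagonal. -/
noncomputable def entrywiseQuotient {m : ℕ} (U P : Matrix (Fin m) (Fin m) ℂ) :
    Matrix (Fin m) (Fin m) ℂ :=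
  Matrix.of fun i j => U i j / P i j

/-- The dual point `Q' = 2 Q / U₊₊`, where `P * Q = U` entrywise. -/
noncomputable def dualPoint {m : ℕ} (U P : Matrix (Fin m) (Fin m) ℂ) :
    Matrix (Fin m) (Fin m) ℂ :=
  (2 / totalSum U) • entrywiseQuotient U P

/-- The likelihood `ℓ_u(P) = ∏_{i<j} p_{ij} ^ u_{ij}` for a table `u` of natural numbers. -/
def likelihood {m : ℕ} (u : Matrix (Fin m) (Fin m) ℕ) (P : Matrix (Fin m) (Fin m) ℂ) : ℂ :=
  ∏ i, ∏ j ∈ Finset.Ioi i, P i j ^ u i j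

/-- The set of all values of the multivalued likelihood `ℓ_U(P) = ∏_{i<j} p_{ij} ^ u_{ij}` for
complex exponents, where `p_{ij} ^ u_{ij} = exp (u_{ij} l_{ij})` for some logarithm `l_{ij}`
of `p_{ij}`. -/
def likelihoodValues {m : ℕ} (U P : Matrix (Fin m) (Fin m) ℂ) : Set ℂ :=
  {z | ∃ L : Matrix (Fin m) (Fin m) ℂ, (∀ i j, i < j → Complex.exp (L i j) = P i j) ∧
    z = ∏ i, ∏ j ∈ Finset.Ioi i, Complex.exp (U i j * L i j)}

end MLDuality

/-! On skew matrices the sum over `i < j` of products of entries is, up to a factor, the trace form,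
and the logarithmic derivative at `P` in direction `V` is the pairing of `V` with the entrywise
quotient `Q = U / P`. Skew matrices of fixed rank near `M` contain the congruence curves with
velocities `A * M + M * Aᵀ`, while every tangent vector vanishes on the left kernel times the right
kernel of `M`. Together these say that a skew `W` annihilates the tangent space exactly when `M * W
= 0`. On `AM m r` the affine condition adds a multiple of `S` with Lagrange multiplier `U₊₊ / 2`, so
criticality reads `P * (Q - (U₊₊ / 2) • S) = 0`; on `AM' m s` it reads `Q * (S - P) = 0`
(`mem_criticalPoints_AM_iff`, `mem_criticalPoints_AM'_iff`). After rescaling, both describe pairs of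
skew matrices with `P * R = 0` and entrywise product of `P` and `S - R` equal to `U`; they differ
only in which of the two ranks is prescribed. The other rank is bounded because `P * R = 0` and
ranks of skew matrices are even. What remains is that for general `U` both bounds are attained.

This is a dimension count, done at generic points (`rank_add_rank_of_algebraicIndependent`). All
entries of a pair with `P * R = 0` are algebraic over chosen entries at positions meeting a set of
at most `rk P + rk R` indices, one for each such unordered position. If the entries of `U` above the
diagonal are algebraically independent, these positions must be all of them, so at most one index is
missed; evenness then forces maximal ranks. The same count makes the pair algebraic over `U`, so the
general fibre of `(P, R) ↦ U` has a constant finite number of points (`exists_systemFiber_encard`),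
the common ML-degree. The likelihood product is constant because `P * Q'` is the fixed matrix `(2 /
U₊₊) • U`. -/

namespace MLDuality

/-! ### Skew matrices over fields -/

section SkewMatrices

variable {F n : Type*} [Field F] [Fintype n] [DecidableEq n]

/-- A skew matrix has an invertible principal submatrix of the size of its rank, from which the
matrix can be recovered using only the rows and columns of that submatrix. -/
theorem exists_principal_submatrix {P : Matrix n n F} (hP : Pᵀ = -P) :
    ∃ I : Finset n, I.card = P.rank ∧
      IsUnit (P.submatrix ((↑) : I → n) ((↑) : I → n)) ∧
      P = P.submatrix id ((↑) : I → n) * (P.submatrix ((↑) : I → n) ((↑) : I → n))⁻¹ *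
        P.submatrix ((↑) : I → n) id := by
  classical
  -- The set `b` indexes rows of `P` that form a basis of the row space; `C` below expresses all
  -- rows in this basis.
  obtain ⟨b, -, -, hspan, hli⟩ := exists_linearIndepOn_extension (K := F) (v := P.row)
    (linearIndepOn_empty F _) (Set.empty_subset Set.univ)
  set I : Finset n := b.toFinset with hI
  have hbI : b = (I : Set n) := by simp [hI]
  rw [hbI] at hspan hli
  have hspan' : ∀ j, P.row j ∈ Submodule.span F (Set.range fun i : I => P.row i) := by
    intro j
    have h := hspan ⟨j, Set.mem_univ j, rfl⟩
    rwa [Set.image_eq_range] at h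
  choose C hC using fun j => (Submodule.mem_span_range_iff_exists_fun F).1 (hspan' j)
  have hli' : LinearIndependent F (P.submatrix ((↑) : I → n) id).row := hli
  have hPC : P = Matrix.of C * P.submatrix ((↑) : I → n) id := by
    ext j k
    rw [Matrix.mul_apply]
    have := congrFun (hC j) k
    simp only [Finset.sum_apply, Pi.smul_apply, smul_eq_mul] at this
    rw [show P j k = P.row j k from rfl, ← this]
    rfl
  have hcol : P.submatrix id ((↑) : I → n) =
      Matrix.of C * P.submatrix ((↑) : I → n) ((↑) : I → n) := by
    conv_lhs => rw [hPC]
    rfl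
  have hskew : ∀ i j, P i j = - P j i := fun i j => by
    have := congrFun (congrFun hP j) i
    simpa using this
  -- By skewness the coefficients that express all rows through the rows in `I` also express all
  -- columns through the columns in `I`. Hence a row relation in the principal block extends to the
  -- full rows, which are independent.
  have hrow : P.submatrix ((↑) : I → n) id =
      P.submatrix ((↑) : I → n) ((↑) : I → n) * (Matrix.of C)ᵀ := by
    ext i k
    have h := congrFun (congrFun hcol k) i
    simp only [Matrix.submatrix_apply, id, Matrix.mul_apply, Matrix.of_apply] at h
    simp only [Matrix.submatrix_apply, id, Matrix.mul_apply, Matrix.transpose_apply,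
      Matrix.of_apply]
    rw [hskew, h, ← Finset.sum_neg_distrib]
    refine Finset.sum_congr rfl fun x _ => ?_
    rw [hskew i x]; ring
  have hunit : IsUnit (P.submatrix ((↑) : I → n) ((↑) : I → n)) := by
    rw [← Matrix.linearIndependent_rows_iff_isUnit, ← Matrix.vecMul_injective_iff]
    rw [← Matrix.vecMul_injective_iff] at hli'
    intro x y hxy
    apply hli'
    simp only [hrow, ← Matrix.vecMul_vecMul]
    exact congrArg (fun z => Matrix.vecMul z (Matrix.of C)ᵀ) hxy
  refine ⟨I, ?_, hunit, ?_⟩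
  · have h1 : (P.submatrix ((↑) : I → n) id).rank = I.card := by
      rw [hli'.rank_matrix, Fintype.card_coe]
    refine le_antisymm (h1 ▸ Matrix.rank_submatrix_le _ _ _) ?_
    rw [← h1]
    conv_lhs => rw [hPC]
    exact Matrix.rank_mul_le_right _ _
  · rw [hcol, Matrix.mul_assoc (Matrix.of C), Matrix.mul_nonsing_inv _
      ((Matrix.isUnit_iff_isUnit_det _).1 hunit), Matrix.mul_one]
    exact hPC

/-- The rank of a skew matrix is even. -/
theorem even_rank_of_skew [CharZero F] {P : Matrix n n F} (hP : Pᵀ = -P) : Even P.rank := by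
  obtain ⟨I, hI, hu, -⟩ := exists_principal_submatrix hP
  rw [Matrix.isUnit_iff_isUnit_det] at hu
  have ht : (P.submatrix ((↑) : I → n) ((↑) : I → n))ᵀ =
      -P.submatrix ((↑) : I → n) ((↑) : I → n) := by
    rw [Matrix.transpose_submatrix, hP]; rfl
  have h := congrArg Matrix.det ht
  rw [Matrix.det_transpose, Matrix.det_neg, Fintype.card_coe, hI] at h
  by_contra hodd
  rw [Nat.not_even_iff_odd] at hodd
  rw [hodd.neg_one_pow, neg_one_mul, eq_neg_iff_add_eq_zero, ← two_mul] at h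
  exact hu.ne_zero (by simpa using h)

/-- A skew matrix has rank at most `r` if and only if all its principal minors of size greater
than `r` vanish. -/
theorem rank_le_iff_principal_minors {P : Matrix n n F} (hP : Pᵀ = -P) (r : ℕ) :
    P.rank ≤ r ↔ ∀ I : Finset n, r < I.card →
      (P.submatrix ((↑) : I → n) ((↑) : I → n)).det = 0 := by
  constructor
  · intro h I hI
    by_contra hne
    have h1 := Matrix.rank_of_isUnit (P.submatrix ((↑) : I → n) ((↑) : I → n))
      ((Matrix.isUnit_iff_isUnit_det _).2 (Ne.isUnit hne))
    have h2 := Matrix.rank_submatrix_le P ((↑) : I → n) ((↑) : I → n)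
    rw [h1, Fintype.card_coe] at h2
    omega
  · intro h
    obtain ⟨I, hI, hu, -⟩ := exists_principal_submatrix hP
    rw [Matrix.isUnit_iff_isUnit_det] at hu
    by_contra hlt
    exact hu.ne_zero (h I (by omega))

/-- By Cramer's rule the entries of the inverse are rational expressions in the entries of the
matrix. -/
theorem inv_apply_mem_subfield (M : Subfield F) {A : Matrix n n F}
    (hA : ∀ i j, A i j ∈ M) (i j : n) : A⁻¹ i j ∈ M := by
  have hdet : ∀ B : Matrix n n F, (∀ i j, B i j ∈ M) → B.det ∈ M := by
    intro B hB
    have : B = (Matrix.of fun i j => (⟨B i j, hB i j⟩ : M)).map M.subtype := by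
      ext; rfl
    rw [this, ← RingHom.mapMatrix_apply, ← RingHom.map_det]
    exact SetLike.coe_mem _
  rw [Matrix.inv_def, Matrix.smul_apply, smul_eq_mul, Ring.inverse_eq_inv']
  refine M.mul_mem (M.inv_mem (hdet A hA)) ?_
  rw [Matrix.adjugate_apply]
  refine hdet _ fun k l => ?_
  by_cases hk : k = j
  · subst hk
    rw [Matrix.updateRow_self]
    by_cases hl : i = l
    · subst hl; simp [M.one_mem]
    · rw [Pi.single_apply]; split_ifs; exacts [M.one_mem, M.zero_mem]
  · rw [Matrix.updateRow_ne hk]; exact hA k l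

end SkewMatrices

theorem mul_apply_mem_subfield {F l n o : Type*} [Field F] [Fintype n] (M : Subfield F) {A : Matrix l n F}
    {B : Matrix n o F} (hA : ∀ i j, A i j ∈ M) (hB : ∀ i j, B i j ∈ M) (i : l) (j : o) :
    (A * B) i j ∈ M := by
  rw [Matrix.mul_apply]
  exact M.sum_mem fun k _ => M.mul_mem (hA _ _) (hB _ _)

/-! ### Pairs of skew matrices with product zero -/

theorem skew_apply {F n : Type*} [Ring F] {P : Matrix n n F} (hP : Pᵀ = -P) (i j : n) :
    P i j = -P j i := by
  simpa using congrFun (congrFun hP j) i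

theorem skew_apply_self {F n : Type*} [Field F] [CharZero F] {P : Matrix n n F} (hP : Pᵀ = -P)
    (i : n) : P i i = 0 := by
  have h := skew_apply hP i i
  rw [eq_neg_iff_add_eq_zero, ← two_mul] at h
  simpa using h

/-- A pair of skew matrices with product zero is determined by a few of its entries. -/
theorem exists_determining_entries {F n : Type*} [Field F] [Fintype n] [DecidableEq n]
    {P R : Matrix n n F} (hP : Pᵀ = -P) (hR : Rᵀ = -R) (hPR : P * R = 0) :
    ∃ (I : Finset n) (J : Finset {i // i ∉ I}), I.card = P.rank ∧ J.card ≤ R.rank ∧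
      ∀ N : Subfield F, (∀ i j, i ∈ I ∨ j ∈ I → P i j ∈ N) →
        (∀ i j : {i // i ∉ I}, i ∈ J ∨ j ∈ J → R i j ∈ N) → ∀ i j, P i j ∈ N ∧ R i j ∈ N := by
  obtain ⟨I, hIc, hIu, hIe⟩ := exists_principal_submatrix hP
  have hR' : (R.submatrix ((↑) : {i // i ∉ I} → n) ((↑) : {i // i ∉ I} → n))ᵀ =
      -R.submatrix ((↑) : {i // i ∉ I} → n) ((↑) : {i // i ∉ I} → n) := by
    rw [Matrix.transpose_submatrix, hR]; rfl
  obtain ⟨J, hJc, hJu, hJe⟩ := exists_principal_submatrix hR'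
  refine ⟨I, J, hIc, hJc.le.trans (Matrix.rank_submatrix_le _ _ _), fun N hPN hRN => ?_⟩
  have hPall : ∀ i j, P i j ∈ N := by
    intro i j
    rw [hIe]
    refine mul_apply_mem_subfield N (mul_apply_mem_subfield N (fun i j => hPN _ _ (Or.inr j.2))
      (inv_apply_mem_subfield N fun i j => hPN _ _ (Or.inl i.2)))
      (fun i j => hPN _ _ (Or.inl i.2)) _ _
  have hRsub : ∀ i j : {i // i ∉ I}, R i j ∈ N := by
    intro i j
    change R.submatrix ((↑) : {i // i ∉ I} → n) ((↑) : {i // i ∉ I} → n) i j ∈ N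
    rw [hJe]
    refine mul_apply_mem_subfield N (mul_apply_mem_subfield N (fun i j => hRN _ _ (Or.inr j.2))
      (inv_apply_mem_subfield N fun i j => hRN _ _ (Or.inl i.2)))
      (fun i j => hRN _ _ (Or.inl i.2)) _ _
  -- The rows of `P * R = 0` with index in `I` form a linear system with invertible matrix for the
  -- rows of `R` in `I`, in terms of the remaining rows.
  have hkey : R.submatrix ((↑) : I → n) id = (P.submatrix ((↑) : I → n) ((↑) : I → n))⁻¹ *
      -(P.submatrix ((↑) : I → n) ((↑) : {i // i ∉ I} → n) *
        R.submatrix ((↑) : {i // i ∉ I} → n) id) := by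
    have h : P.submatrix ((↑) : I → n) ((↑) : I → n) * R.submatrix ((↑) : I → n) id =
        -(P.submatrix ((↑) : I → n) ((↑) : {i // i ∉ I} → n) *
        R.submatrix ((↑) : {i // i ∉ I} → n) id) := by
      rw [eq_neg_iff_add_eq_zero]
      ext i j
      have := congrFun (congrFun hPR i) j
      rw [Matrix.mul_apply, ← Fintype.sum_subtype_add_sum_subtype (fun x => x ∈ I)] at this
      rw [Matrix.add_apply, Matrix.mul_apply, Matrix.mul_apply]
      convert this <;> rfl
    rw [← h, ← Matrix.mul_assoc, Matrix.nonsing_inv_mul _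
      ((Matrix.isUnit_iff_isUnit_det _).1 hIu), Matrix.one_mul]
  have hstep : ∀ j, (∀ i, i ∉ I → R i j ∈ N) → ∀ i, R i j ∈ N := by
    intro j hj i
    by_cases hi : i ∈ I
    · have h := congrFun (congrFun (congrArg (fun A => A.submatrix id
        (fun _ : Unit => j)) hkey) ⟨i, hi⟩) ()
      simp only [Matrix.submatrix_apply, id] at h
      rw [h, Matrix.mul_apply]
      refine N.sum_mem fun x _ => N.mul_mem (inv_apply_mem_subfield N (fun _ _ => hPall _ _) _ _) ?_
      rw [Matrix.neg_apply, Matrix.mul_apply]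
      exact N.neg_mem (N.sum_mem fun y _ => N.mul_mem (hPall _ _) (hj _ y.2))
    · exact hj i hi
  have hRcol : ∀ i j, j ∉ I → R i j ∈ N := fun i j hj =>
    hstep j (fun i hi => hRsub ⟨i, hi⟩ ⟨j, hj⟩) i
  -- Columns outside `I` are already known. Skewness turns them into rows outside `I`, and these
  -- determine every column.
  refine fun i j => ⟨hPall i j, hstep j (fun i hi => ?_) i⟩
  rw [skew_apply hR]
  exact N.neg_mem (hRcol j i hi)

/-! ### Algebraic independence and the dimension count -/

section Algebraic

variable {k L : Type*} [Field k] [Field L] [Algebra k L]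

/-- The subfield of the elements that are algebraic over `k[s]`. -/
def algebraicSubfield (k : Type*) {L : Type*} [Field k] [Field L] [Algebra k L] (s : Set L) :
    Subfield L where
  __ := (Subalgebra.algebraicClosure (Algebra.adjoin k s) L).toSubring
  inv_mem' _ h := IsAlgebraic.inv h

theorem mem_algebraicSubfield_of_mem {s : Set L} {x : L} (hx : x ∈ s) :
    x ∈ algebraicSubfield k s :=
  isAlgebraic_algebraMap (⟨x, Algebra.subset_adjoin hx⟩ : Algebra.adjoin k s)

/-- If an algebraically independent family is algebraic over a subfamily of another family with
the same finite index set, then the subfamily is the whole family. -/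
theorem eq_univ_of_algebraicIndependent {ι : Type*} [Finite ι] {u w : ι → L} {E : Set ι}
    (hu : AlgebraicIndependent k u) (h : ∀ i, u i ∈ algebraicSubfield k (w '' E)) :
    E = Set.univ ∧ ∀ x ∈ algebraicSubfield k (w '' E), x ∈ algebraicSubfield k (Set.range u) := by
  have : FaithfulSMul k L := inferInstance
  set M := AlgebraicIndependent.matroid k L
  have hcl : ∀ s : Set L, M.closure s = (algebraicSubfield k s : Set L) :=
    fun s => AlgebraicIndependent.matroid_closure_eq
  have hI : M.Indep (Set.range u) :=
    AlgebraicIndependent.matroid_indep_iff.2 hu.to_subtype_range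
  have hsub : Set.range u ⊆ M.closure (w '' E) := by
    rw [hcl]; rintro _ ⟨i, rfl⟩; exact h i
  -- Rank comparison in the matroid of algebraic independence; with the finite index set `ι` on both
  -- sides it forces `E` to be everything and the two closures to agree.
  have h1 : (Set.range u).encard ≤ (w '' E).encard :=
    ((hI.encard_le_eRk_of_subset hsub).trans_eq (M.eRk_closure_eq _)).trans (M.eRk_le_encard _)
  have h2 : (Set.range u).encard = (Set.univ : Set ι).encard := by
    rw [← Set.image_univ, hu.injective.encard_image]
  have h3 : (w '' E).encard ≤ E.encard := Set.encard_image_le _ _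
  refine ⟨Set.Finite.eq_of_subset_of_encard_le (Set.toFinite _) (Set.subset_univ _)
    (h2 ▸ h1.trans h3), ?_⟩
  have h4 : M.closure (Set.range u) = M.closure (M.closure (w '' E)) := by
    refine (M.isRkFinite_of_finite (Set.finite_range u)).closure_eq_closure_of_subset_of_eRk_ge_eRk
      hsub ?_
    rw [M.eRk_closure_eq, hI.eRk_eq_encard]
    refine (M.eRk_le_encard _).trans (h3.trans ?_)
    rw [h2]
    exact Set.encard_le_encard (Set.subset_univ _)
  rw [M.closure_closure, hcl, hcl] at h4
  intro x hx
  exact h4.symm.subset hx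

/-- If `P` and `R` are skew matrices with `P * R = 0` for which the entries of the entrywise
product of `P` and `S - R` above the diagonal are algebraically independent, then the rank of
`P` and `R` is as large as possible and all entries are algebraic over those entries. -/
theorem rank_add_rank_of_algebraicIndependent [CharZero L] {m : ℕ} {P R : Matrix (Fin m) (Fin m) L}
    (hP : Pᵀ = -P) (hR : Rᵀ = -R) (hPR : P * R = 0) {u : {p : Fin m × Fin m // p.1 < p.2} → L}
    (hu' : ∀ p, u p = P p.1.1 p.1.2 * (1 - R p.1.1 p.1.2))
    (hu : AlgebraicIndependent k u) :
    m ≤ P.rank + R.rank + 1 ∧ ∀ i j, IsAlgebraic (Algebra.adjoin k (Set.range u)) (P i j) ∧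
      IsAlgebraic (Algebra.adjoin k (Set.range u)) (R i j) := by
  obtain ⟨I, J, hI, hJ, hdet⟩ := exists_determining_entries hP hR hPR
  set J' : Finset (Fin m) := J.image (↑) with hJ'
  have hJm : ∀ i : {i // i ∉ I}, (i : Fin m) ∈ J' ↔ i ∈ J := fun i => by
    simp only [hJ', Finset.mem_image]
    exact ⟨fun ⟨a, ha, hai⟩ => Subtype.ext hai ▸ ha, fun h => ⟨i, h, rfl⟩⟩
  -- One entry for each position: the one of `P` if the position meets `I`, otherwise the one of
  -- `R`. The determining entries of both matrices then fit into a family with the same index set as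
  -- `u`, supported on `E`.
  set w : {p : Fin m × Fin m // p.1 < p.2} → L := fun p =>
    if p.1.1 ∈ I ∨ p.1.2 ∈ I then P p.1.1 p.1.2 else R p.1.1 p.1.2 with hw
  set E : Set {p : Fin m × Fin m // p.1 < p.2} :=
    {p | p.1.1 ∈ I ∪ J' ∨ p.1.2 ∈ I ∪ J'} with hE
  have hmemP : ∀ i j, i ∈ I ∨ j ∈ I → P i j ∈ algebraicSubfield k (w '' E) := by
    have : ∀ i j, i < j → i ∈ I ∨ j ∈ I → P i j ∈ algebraicSubfield k (w '' E) := by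
      intro i j hij h
      refine mem_algebraicSubfield_of_mem ⟨⟨(i, j), hij⟩, ?_, ?_⟩
      · exact h.imp (Finset.mem_union_left _) (Finset.mem_union_left _)
      · simp [hw, h]
    intro i j h
    rcases lt_trichotomy i j with hij | rfl | hij
    · exact this i j hij h
    · rw [skew_apply_self hP]; exact Subfield.zero_mem _
    · rw [skew_apply hP]; exact Subfield.neg_mem _ (this j i hij h.symm)
  have hmemR : ∀ i j : {i // i ∉ I}, i ∈ J ∨ j ∈ J → R i j ∈ algebraicSubfield k (w '' E) := by
    have : ∀ i j : {i // i ∉ I}, i < j → i ∈ J ∨ j ∈ J →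
        R i j ∈ algebraicSubfield k (w '' E) := by
      intro i j hij h
      refine mem_algebraicSubfield_of_mem ⟨⟨(i, j), hij⟩, ?_, ?_⟩
      · exact h.imp (fun h => Finset.mem_union_right _ ((hJm i).2 h))
          (fun h => Finset.mem_union_right _ ((hJm j).2 h))
      · simp [hw, i.2, j.2]
    intro i j h
    rcases lt_trichotomy i j with hij | rfl | hij
    · exact this i j hij h
    · rw [skew_apply_self hR]; exact Subfield.zero_mem _
    · rw [skew_apply hR]; exact Subfield.neg_mem _ (this j i hij h.symm)
  have hall := hdet _ hmemP hmemR
  obtain ⟨hEu, hcl⟩ := eq_univ_of_algebraicIndependent hu (w := w) (E := E) fun p => by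
    rw [hu']
    exact Subfield.mul_mem _ (hall _ _).1 (Subfield.sub_mem _ (Subfield.one_mem _) (hall _ _).2)
  refine ⟨?_, fun i j => ⟨hcl _ (hall i j).1, hcl _ (hall i j).2⟩⟩
  -- Two distinct indices outside `I ∪ J'` would give a position outside `E`. A single leftover
  -- index lies in no such pair, whence the `+ 1` in the bound.
  have hK : (I ∪ J')ᶜ.card ≤ 1 := by
    rw [Finset.card_le_one]
    have : ∀ a b, a < b → a ∈ (I ∪ J')ᶜ → b ∈ (I ∪ J')ᶜ → False := by
      intro a b hab ha hb
      have : (⟨(a, b), hab⟩ : {p : Fin m × Fin m // p.1 < p.2}) ∈ E := hEu ▸ Set.mem_univ _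
      rw [Finset.mem_compl] at ha hb
      exact this.elim ha hb
    intro a ha b hb
    rcases lt_trichotomy a b with h | h | h
    · exact (this a b h ha hb).elim
    · exact h
    · exact (this b a h hb ha).elim
  rw [Finset.card_compl, Fintype.card_fin] at hK
  have h1 := Finset.card_union_le I J'
  have h2 : J'.card ≤ J.card := Finset.card_image_le
  omega

end Algebraic

/-! ### The number of points in a general fibre -/

theorem encard_biUnion_finset {ι α : Type*} (s : Finset ι) (F : ι → Set α) (d : ι → ℕ)
    (hF : ∀ i ∈ s, (F i).encard = d i) (hd : (s : Set ι).PairwiseDisjoint F) :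
    (⋃ i ∈ s, F i).encard = ((∑ i ∈ s, d i : ℕ) : ℕ∞) := by
  classical
  induction s using Finset.induction_on with
  | empty => simp
  | insert a s ha ih =>
    rw [Finset.set_biUnion_insert, Set.encard_union_eq, hF a (Finset.mem_insert_self _ _),
      ih (fun i hi => hF i (Finset.mem_insert_of_mem hi))
        (hd.subset (by simp)), Finset.sum_insert ha]
    · push_cast; rfl
    · rw [Set.disjoint_iUnion₂_right]
      intro i hi
      exact hd (by simp) (by simp [hi]) (fun h => ha (h ▸ hi))

/-- The ring homomorphism `φ` has, over every sufficiently general `Ω`-valued point, the same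
finite number of points in its fibre. -/
def HasGenericFiberCard {A C : Type*} [CommRing A] [CommRing C] (φ : A →+* C)
    (Ω : Type*) [Field Ω] : Prop :=
  ∃ f : A, f ≠ 0 ∧ ∃ d : ℕ, ∀ χ : A →+* Ω, χ f ≠ 0 →
    {ψ : C →+* Ω | ψ.comp φ = χ}.encard = d

/-- Pseudo-division: cancelling leading terms lowers the degree at the price of a factor
`g.leadingCoeff`, and by minimality this can only stop at zero. -/
theorem exists_pow_mul_eq_mul_of_minimal {B C : Type*} [CommRing B] [IsDomain B] [CommRing C]
    [Algebra B C] {c : C} {g : Polynomial B} (hg : g ≠ 0) (hgc : Polynomial.aeval c g = 0)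
    (hmin : ∀ h : Polynomial B, h ≠ 0 → Polynomial.aeval c h = 0 → g.natDegree ≤ h.natDegree)
    (h : Polynomial B) (hc : Polynomial.aeval c h = 0) :
    ∃ (N : ℕ) (q : Polynomial B), Polynomial.C (g.leadingCoeff ^ N) * h = q * g := by
  induction hn : h.natDegree using Nat.strong_induction_on generalizing h with
  | _ n ih =>
  by_cases h0 : h = 0
  · exact ⟨0, 0, by simp [h0]⟩
  set h1 := Polynomial.C g.leadingCoeff * h -
    Polynomial.C h.leadingCoeff * Polynomial.X ^ (h.natDegree - g.natDegree) * g with hh1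
  have hle := hmin h h0 hc
  have hlg : g.leadingCoeff ≠ 0 := Polynomial.leadingCoeff_ne_zero.2 hg
  have hlh : h.leadingCoeff ≠ 0 := Polynomial.leadingCoeff_ne_zero.2 h0
  have hc1 : Polynomial.aeval c h1 = 0 := by simp [hh1, hc, hgc]
  have hex : ∃ (N : ℕ) (q : Polynomial B), Polynomial.C (g.leadingCoeff ^ N) * h1 = q * g := by
    by_cases h10 : h1 = 0
    · exact ⟨0, 0, by simp [h10]⟩
    refine ih h1.natDegree ?_ h1 hc1 rfl
    have hdeg : h1.degree < h.degree := by
      have e1 : (Polynomial.C g.leadingCoeff * h).degree = h.degree :=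
        Polynomial.degree_C_mul hlg
      rw [← e1]
      refine Polynomial.degree_sub_lt_left ?_ (mul_ne_zero (by simpa using hlg) h0) ?_
      · rw [e1, Polynomial.degree_mul, Polynomial.degree_C_mul_X_pow _ hlh,
          Polynomial.degree_eq_natDegree hg, Polynomial.degree_eq_natDegree h0, ← Nat.cast_add,
          Nat.sub_add_cancel hle]
      · rw [Polynomial.leadingCoeff_mul, Polynomial.leadingCoeff_mul, Polynomial.leadingCoeff_mul,
          Polynomial.leadingCoeff_C, Polynomial.leadingCoeff_C, Polynomial.leadingCoeff_X_pow,
          mul_one, mul_comm]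
    rw [← hn]
    exact Polynomial.natDegree_lt_natDegree h10 hdeg
  obtain ⟨N, q, hq⟩ := hex
  refine ⟨N + 1, q + Polynomial.C (g.leadingCoeff ^ N) *
    (Polynomial.C h.leadingCoeff * Polynomial.X ^ (h.natDegree - g.natDegree)), ?_⟩
  rw [add_mul, ← hq, hh1, pow_succ, Polynomial.C_mul]
  ring

/-- The number of points in a general fibre, for an extension of domains that is generated by a
single algebraic element. -/
theorem hasGenericFiberCard_of_monogenic {B C Ω : Type*} [CommRing B] [IsDomain B] [CharZero B]
    [CommRing C] [IsDomain C] [Algebra B C] [FaithfulSMul B C] [Field Ω] [IsAlgClosed Ω]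
    (c : C) (hgen : Function.Surjective (Polynomial.aeval (R := B) c))
    (halg : Algebra.IsAlgebraic B C) :
    HasGenericFiberCard (algebraMap B C) Ω := by
  classical
  have hex : ∃ n, ∃ g : Polynomial B, g ≠ 0 ∧ Polynomial.aeval c g = 0 ∧ g.natDegree = n := by
    obtain ⟨g, hg, hgc⟩ := halg.isAlgebraic c
    exact ⟨_, g, hg, hgc, rfl⟩
  obtain ⟨g, hg, hgc, hgn⟩ := Nat.find_spec hex
  have hmin : ∀ h : Polynomial B, h ≠ 0 → Polynomial.aeval c h = 0 →
      g.natDegree ≤ h.natDegree := fun h h0 h1 => hgn ▸ Nat.find_min' hex ⟨h, h0, h1, rfl⟩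
  have hdiv := exists_pow_mul_eq_mul_of_minimal hg hgc hmin
  have hpos : 0 < g.natDegree := by
    rw [Nat.pos_iff_ne_zero]
    intro h0
    obtain ⟨b, rfl⟩ := Polynomial.natDegree_eq_zero.1 h0
    rw [Polynomial.aeval_C, map_eq_zero_iff _ (FaithfulSMul.algebraMap_injective B C)] at hgc
    exact hg (by simp [hgc])
  have hder0 : Polynomial.derivative g ≠ 0 := by
    intro h
    exact hpos.ne' (Polynomial.derivative_eq_zero.1 h)
  -- Characteristic zero and minimality of the degree make `c` a simple root. A nonzero multiple `e
  -- ∈ B` of the value `g'(c)` then serves as a substitute for the discriminant.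
  have hder : Polynomial.aeval c (Polynomial.derivative g) ≠ 0 := fun h =>
    absurd (hmin _ hder0 h) (not_le.2 (Polynomial.natDegree_derivative_lt hpos.ne'))
  obtain ⟨e, he, y, hy⟩ := (halg.isAlgebraic (Polynomial.aeval c
    (Polynomial.derivative g))).exists_nonzero_dvd (mem_nonZeroDivisors_of_ne_zero hder)
  obtain ⟨v, rfl⟩ := hgen y
  obtain ⟨N, q, hq⟩ := hdiv (Polynomial.derivative g * v - Polynomial.C e) (by
    rw [map_sub, map_mul, Polynomial.aeval_C, ← hy, sub_self])
  refine ⟨g.leadingCoeff * e, mul_ne_zero (Polynomial.leadingCoeff_ne_zero.2 hg) he, g.natDegree,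
    fun χ hχ => ?_⟩
  rw [map_mul] at hχ
  have hχa : χ g.leadingCoeff ≠ 0 := left_ne_zero_of_mul hχ
  have hχe : χ e ≠ 0 := right_ne_zero_of_mul hχ
  -- The pseudo-division identity `hq` specializes to a Bézout identity for `g` and its derivative,
  -- since neither the leading coefficient nor `e` is killed by `χ`.
  have hsep : (g.map χ).Separable := by
    set w := (χ (g.leadingCoeff ^ N * e))⁻¹
    have hw : χ (g.leadingCoeff ^ N * e) * w = 1 := mul_inv_cancel₀ (by
      rw [map_mul, map_pow]; exact mul_ne_zero (pow_ne_zero _ hχa) hχe)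
    have hq' := congrArg (Polynomial.map χ) hq
    simp only [Polynomial.map_mul, Polynomial.map_sub, Polynomial.map_C] at hq'
    refine (Polynomial.separable_def' _).2 ⟨-q.map χ * Polynomial.C w,
      Polynomial.C (χ (g.leadingCoeff ^ N)) * v.map χ * Polynomial.C w, ?_⟩
    rw [Polynomial.derivative_map]
    have hw' := congrArg Polynomial.C hw
    rw [map_mul χ, Polynomial.C_mul, Polynomial.C_mul, Polynomial.C_1] at hw'
    linear_combination Polynomial.C w * hq' + hw'
  have hmap : g.map χ ≠ 0 := hsep.ne_zero
  have hinj : Set.InjOn (fun ψ : C →+* Ω => ψ c) {ψ | ψ.comp (algebraMap B C) = χ} := by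
    intro ψ hψ ψ' hψ' h
    ext y
    obtain ⟨p, rfl⟩ := hgen y
    simp only [Set.mem_ofPred_eq] at hψ hψ' h
    rw [Polynomial.aeval_def, Polynomial.hom_eval₂, Polynomial.hom_eval₂, hψ, hψ', h]
  have himg : (fun ψ : C →+* Ω => ψ c) '' {ψ | ψ.comp (algebraMap B C) = χ} =
      ((g.map χ).roots.toFinset : Set Ω) := by
    ext t
    simp only [Set.mem_image, Set.mem_ofPred_eq, Finset.mem_coe, Multiset.mem_toFinset,
      Polynomial.mem_roots hmap, Polynomial.IsRoot.def, Polynomial.eval_map]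
    constructor
    · rintro ⟨ψ, hψ, rfl⟩
      rw [← hψ, ← Polynomial.hom_eval₂, ← Polynomial.aeval_def, hgc, map_zero]
    · intro ht
      set F : Polynomial B →+* C := (Polynomial.aeval (R := B) c : Polynomial B →ₐ[B] C).toRingHom
      have hF : Function.Surjective F := hgen
      -- Evaluation at a root `t` descends to `C`: a relation satisfied by `c` is a multiple of `g`
      -- up to a power of the leading coefficient, which `χ` makes invertible.
      have hker : RingHom.ker F ≤ RingHom.ker (Polynomial.eval₂RingHom χ t) := by
        intro h hh
        obtain ⟨M, r, hr⟩ := hdiv h hh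
        have := congrArg (Polynomial.eval₂ χ t) hr
        rw [Polynomial.eval₂_mul, Polynomial.eval₂_mul, ht, mul_zero, Polynomial.eval₂_C,
          map_pow] at this
        exact (mul_eq_zero.1 this).resolve_left (pow_ne_zero _ hχa)
      have hlift : ∀ p, F.liftOfSurjective hF ⟨_, hker⟩ (F p) = Polynomial.eval₂ χ t p :=
        fun p => RingHom.liftOfRightInverse_comp_apply F _ _ ⟨_, hker⟩ p
      refine ⟨F.liftOfSurjective hF ⟨_, hker⟩, ?_, ?_⟩
      · ext b
        have := hlift (Polynomial.C b)
        rw [Polynomial.eval₂_C] at this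
        rw [← this]
        simp [F]
      · have := hlift Polynomial.X
        rw [Polynomial.eval₂_X] at this
        have hX : F Polynomial.X = c := Polynomial.aeval_X c
        rwa [hX] at this
  rw [← hinj.encard_image, himg, Set.encard_coe_eq_coe_finsetCard,
    Multiset.toFinset_card_of_nodup (Polynomial.nodup_roots hsep),
    Polynomial.splits_iff_card_roots.1 (IsAlgClosed.splits _),
    Polynomial.natDegree_map_of_leadingCoeff_ne_zero _ hχa]

/-- The fibre of the composite is the disjoint union of the upper fibres over the points of the
lower fibre. The exceptional element `f'` of `B` has a nonzero multiple in `A`, because `B` is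
algebraic over `A`, so avoiding it is a condition on the base. -/
theorem HasGenericFiberCard.comp {A B C Ω : Type*} [CommRing A] [IsDomain A] [CommRing B]
    [IsDomain B] [CommRing C] [Field Ω] [Algebra A B] [Algebra.IsAlgebraic A B]
    {θ : B →+* C} (h1 : HasGenericFiberCard (algebraMap A B) Ω) (h2 : HasGenericFiberCard θ Ω) :
    HasGenericFiberCard (θ.comp (algebraMap A B)) Ω := by
  obtain ⟨f, hf, d, hd⟩ := h1
  obtain ⟨f', hf', d', hd'⟩ := h2
  obtain ⟨a, ha, y, hy⟩ := (Algebra.IsAlgebraic.isAlgebraic (R := A) f').exists_nonzero_dvd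
    (mem_nonZeroDivisors_of_ne_zero hf')
  refine ⟨f * a, mul_ne_zero hf ha, d * d', fun χ hχ => ?_⟩
  rw [map_mul] at hχ
  have hS := hd χ (left_ne_zero_of_mul hχ)
  have hfin : {ψ : B →+* Ω | ψ.comp (algebraMap A B) = χ}.Finite := by
    rw [← Set.encard_ne_top_iff, hS]; exact ENat.natCast_ne_top _
  have hU : {ψ : C →+* Ω | ψ.comp (θ.comp (algebraMap A B)) = χ} =
      ⋃ ψ' ∈ hfin.toFinset, {ψ : C →+* Ω | ψ.comp θ = ψ'} := by
    ext ψ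
    simp [RingHom.comp_assoc]
  rw [hU, encard_biUnion_finset _ _ (fun _ => d'), Finset.sum_const, smul_eq_mul]
  · rw [hfin.encard_eq_coe_toFinset_card] at hS
    rw [Nat.cast_inj.1 hS]
  · intro ψ' hψ'
    rw [Set.Finite.mem_toFinset, Set.mem_ofPred_eq] at hψ'
    refine hd' ψ' fun h0 => right_ne_zero_of_mul hχ ?_
    rw [← hψ', RingHom.comp_apply, hy, map_mul, h0, zero_mul]
  · intro ψ₁ _ ψ₂ _ hne
    refine Set.disjoint_left.2 fun ψ h1 h2 => hne ?_
    exact h1.symm.trans h2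

/-- The number of points in a general fibre, for an algebraic extension of domains of finite
type. -/
theorem hasGenericFiberCard_of_finiteType {A C Ω : Type*} [CommRing A] [IsDomain A] [CharZero A]
    [CommRing C] [IsDomain C] [Algebra A C] [FaithfulSMul A C] [Algebra.FiniteType A C]
    [Algebra.IsAlgebraic A C] [Field Ω] [IsAlgClosed Ω] :
    HasGenericFiberCard (algebraMap A C) Ω := by
  classical
  have halg : ∀ S : Subalgebra A C, Algebra.IsAlgebraic A S := fun S =>
    Algebra.IsAlgebraic.of_injective S.val Subtype.val_injective
  have hfaith : ∀ S : Subalgebra A C, FaithfulSMul A S := fun S =>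
    (faithfulSMul_iff_algebraMap_injective A S).2 fun a b h =>
      FaithfulSMul.algebraMap_injective A C (congrArg Subtype.val h)
  have hchar : CharZero C :=
    charZero_of_injective_algebraMap (FaithfulSMul.algebraMap_injective A C)
  have hcharS : ∀ S : Subalgebra A C, CharZero S := fun S =>
    charZero_of_injective_algebraMap (FaithfulSMul.algebraMap_injective A S)
  -- Adjoin the generators one at a time, so that each step is generated by a single algebraic
  -- element.
  have key : ∀ t : Finset C,
      HasGenericFiberCard (algebraMap A (Algebra.adjoin A (t : Set C))) Ω := by
    intro t
    induction t using Finset.induction_on with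
    | empty =>
      refine hasGenericFiberCard_of_monogenic (0 : Algebra.adjoin A ((∅ : Finset C) : Set C))
        ?_ (halg _)
      rintro ⟨y, hy⟩
      rw [Finset.coe_empty, Algebra.adjoin_empty, Algebra.mem_bot] at hy
      obtain ⟨a, rfl⟩ := hy
      refine ⟨Polynomial.C a, ?_⟩
      rw [Polynomial.aeval_C]
      rfl
    | insert x t _ ih =>
      set B := Algebra.adjoin A (t : Set C)
      set D := Algebra.adjoin A ((insert x t : Finset C) : Set C) with hD
      have hle : B ≤ D := Algebra.adjoin_mono (by simp)
      let : Algebra B D := (Subalgebra.inclusion hle).toRingHom.toAlgebra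
      have : IsScalarTower A B D := IsScalarTower.of_algebraMap_eq fun _ => rfl
      have : IsScalarTower B D C := IsScalarTower.of_algebraMap_eq fun _ => rfl
      have : FaithfulSMul B D := (faithfulSMul_iff_algebraMap_injective B D).2
        (Subalgebra.inclusion_injective hle)
      have : Algebra.IsAlgebraic B D := 
        Algebra.IsAlgebraic.extendScalars (FaithfulSMul.algebraMap_injective A B)
      have hx : x ∈ D := Algebra.subset_adjoin (by simp)
      have hstep : HasGenericFiberCard (algebraMap B D) Ω := by
        refine hasGenericFiberCard_of_monogenic (⟨x, hx⟩ : D) ?_ inferInstance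
        have hsub : D ≤ ((Polynomial.aeval (R := B) x).range).restrictScalars A := by
          rw [hD, Algebra.adjoin_le_iff, Finset.coe_insert, Set.insert_subset_iff]
          refine ⟨⟨Polynomial.X, Polynomial.aeval_X x⟩, fun y hy => ?_⟩
          refine ⟨Polynomial.C ⟨y, Algebra.subset_adjoin hy⟩, ?_⟩
          exact Polynomial.aeval_C x _
        intro y
        obtain ⟨p, hp⟩ := hsub y.2
        refine ⟨p, Subtype.ext ?_⟩
        rw [← hp]
        exact (Polynomial.aeval_algebraMap_apply C (⟨x, hx⟩ : D) p).symm
      exact ih.comp hstep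
  obtain ⟨t, ht⟩ := (Algebra.FiniteType.out : (⊤ : Subalgebra A C).FG)
  obtain ⟨f, hf, d, hd⟩ := key t
  refine ⟨f, hf, d, fun χ hχ => ?_⟩
  rw [← hd χ hχ]
  have e : Algebra.adjoin A (t : Set C) ≃ₐ[A] C :=
    (Subalgebra.equivOfEq _ _ ht).trans Subalgebra.topEquiv
  have hinj : Function.Injective fun ψ : C →+* Ω => ψ.comp (RingHomClass.toRingHom e) := by
    intro ψ ψ' h
    ext y
    obtain ⟨z, rfl⟩ := e.surjective y
    exact RingHom.congr_fun h z
  rw [← hinj.encard_image]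
  congr 1
  ext ψ
  simp only [Set.mem_image, Set.mem_ofPred_eq]
  constructor
  · rintro ⟨ψ', rfl, rfl⟩
    ext a
    simp
  · rintro rfl
    refine ⟨ψ.comp (RingHomClass.toRingHom e.symm), ?_, ?_⟩
    · ext a
      simp
    · ext a
      simp

/-! ### General fibres of polynomial systems -/

section PolynomialSystems

open MvPolynomial

variable {k τ ι : Type} [Field k]

/-- The points with `φ`-image `u` in the zero set of `E`. -/
def systemFiber (E : Set (MvPolynomial τ k)) (φ : ι → MvPolynomial τ k) (u : ι → k) :
    Set (τ → k) :=
  {z | (∀ p ∈ E, eval z p = 0) ∧ ∀ i, eval z (φ i) = u i}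

theorem eval_aeval (φ : ι → MvPolynomial τ k) (z : τ → k) (f : MvPolynomial ι k) :
    eval z (aeval φ f) = eval (fun i => eval z (φ i)) f := by
  have h := MvPolynomial.comp_aeval_apply φ (aeval z) f
  simpa only [MvPolynomial.aeval_eq_eval] using h

theorem eval_aeval_of_mem_systemFiber {E : Set (MvPolynomial τ k)} {φ : ι → MvPolynomial τ k}
    {u : ι → k} {z : τ → k} (hz : z ∈ systemFiber E φ u) (f : MvPolynomial ι k) :
    eval z (aeval φ f) = eval u f := by
  rw [eval_aeval, show (fun i => eval z (φ i)) = u from funext hz.2]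

theorem isPrime_ker_eval (z : τ → k) : (RingHom.ker (eval z)).IsPrime :=
  RingHom.ker_isPrime _

/-- The generic point of the zero set of a prime ideal. -/
noncomputable def genericPoint (p : Ideal (MvPolynomial τ k)) [p.IsPrime] (t : τ) :
    FractionRing (MvPolynomial τ k ⧸ p) :=
  algebraMap (MvPolynomial τ k ⧸ p) _ (Ideal.Quotient.mk p (X t))

theorem aeval_genericPoint (p : Ideal (MvPolynomial τ k)) [p.IsPrime] (q : MvPolynomial τ k) :
    aeval (genericPoint p) q =
      algebraMap (MvPolynomial τ k ⧸ p) (FractionRing (MvPolynomial τ k ⧸ p))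
        (Ideal.Quotient.mk p q) := by
  have : aeval (genericPoint p) = (IsScalarTower.toAlgHom k (MvPolynomial τ k ⧸ p)
      (FractionRing (MvPolynomial τ k ⧸ p))).comp (Ideal.Quotient.mkₐ k p) := by
    ext t
    simp [genericPoint]
  rw [this]
  rfl

theorem aeval_genericPoint_eq_zero (p : Ideal (MvPolynomial τ k)) [p.IsPrime]
    {q : MvPolynomial τ k} : aeval (genericPoint p) q = 0 ↔ q ∈ p := by
  rw [aeval_genericPoint, map_eq_zero_iff _ (IsFractionRing.injective _ _),
    Ideal.Quotient.eq_zero_iff_mem]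

theorem algebraicIndependent_genericPoint (p : Ideal (MvPolynomial τ k)) [p.IsPrime]
    {φ : ι → MvPolynomial τ k} (h : ∀ f : MvPolynomial ι k, aeval φ f ∈ p → f = 0) :
    AlgebraicIndependent k (fun i => aeval (genericPoint p) (φ i)) := by
  rw [algebraicIndependent_iff]
  intro f hf
  refine h f ((aeval_genericPoint_eq_zero p).1 ?_)
  rw [← hf]
  exact MvPolynomial.comp_aeval_apply φ (aeval (genericPoint p)) f

/-- If a prime ideal dominates the base and its generic point is algebraic over the base, then
its general fibre has a constant finite number of points, and every larger ideal meets
the base. -/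
theorem prime_fiber_card [Finite τ] [IsAlgClosed k] [CharZero k]
    (p : Ideal (MvPolynomial τ k)) [p.IsPrime] {φ : ι → MvPolynomial τ k}
    (h : ∀ f : MvPolynomial ι k, aeval φ f ∈ p → f = 0)
    (halg : ∀ t, IsAlgebraic (Algebra.adjoin k (Set.range fun i => aeval (genericPoint p) (φ i)))
      (genericPoint p t)) :
    (∃ f : MvPolynomial ι k, f ≠ 0 ∧ ∃ d : ℕ, ∀ u : ι → k, eval u f ≠ 0 →
      (systemFiber (p : Set (MvPolynomial τ k)) φ u).encard = d) ∧
    ∀ y, y ∉ p → ∃ a : MvPolynomial ι k, a ≠ 0 ∧ ∃ c, aeval φ a - y * c ∈ p := by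
  set C := MvPolynomial τ k ⧸ p with hC
  set Φ : MvPolynomial ι k →ₐ[k] C := (Ideal.Quotient.mkₐ k p).comp (aeval φ) with hΦ
  let _ : Algebra (MvPolynomial ι k) C := Φ.toRingHom.toAlgebra
  have hmap : ∀ f, algebraMap (MvPolynomial ι k) C f = Ideal.Quotient.mk p (aeval φ f) :=
    fun _ => rfl
  have : IsScalarTower k (MvPolynomial ι k) C :=
    IsScalarTower.of_algebraMap_eq fun x => (Φ.commutes x).symm
  have : FaithfulSMul (MvPolynomial ι k) C := by
    rw [faithfulSMul_iff_algebraMap_injective, injective_iff_map_eq_zero]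
    intro f hf
    rw [hmap, Ideal.Quotient.eq_zero_iff_mem] at hf
    exact h f hf
  have : Algebra.FiniteType k C := inferInstance
  have : Algebra.FiniteType (MvPolynomial ι k) C :=
    Algebra.FiniteType.of_restrictScalars_finiteType k _ C
  have hind := algebraicIndependent_genericPoint p h
  -- Algebraic independence identifies the subalgebra generated by the image of `φ` with a
  -- polynomial ring; the algebraic relations are transported along this identification.
  have hX : ∀ t, IsAlgebraic (MvPolynomial ι k) (Ideal.Quotient.mk p (X t) : C) := by
    intro t
    obtain ⟨P, hP, hP0⟩ := halg t
    refine ⟨P.map (hind.aevalEquiv.symm : _ ≃+* _).toRingHom, ?_, ?_⟩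
    · rwa [Ne, Polynomial.map_eq_zero_iff (RingEquiv.injective _)]
    · apply IsFractionRing.injective C (FractionRing C)
      rw [map_zero, Polynomial.aeval_def, Polynomial.hom_eval₂, Polynomial.eval₂_map, ← hP0,
        Polynomial.aeval_def]
      congr 1
      ext x
      obtain ⟨f, rfl⟩ := hind.aevalEquiv.surjective x
      have hsymm : (hind.aevalEquiv.symm : _ ≃+* _).toRingHom (hind.aevalEquiv f) = f :=
        hind.aevalEquiv.symm_apply_apply f
      rw [RingHom.comp_apply, RingHom.comp_apply, hsymm, hind.algebraMap_aevalEquiv]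
      refine (aeval_genericPoint p (aeval φ f)).symm.trans ?_
      exact MvPolynomial.comp_aeval_apply φ (aeval (genericPoint p)) f
  have hCalg : Algebra.IsAlgebraic (MvPolynomial ι k) C := by
    refine ⟨fun y => ?_⟩
    obtain ⟨q, rfl⟩ := Ideal.Quotient.mk_surjective y
    induction q using MvPolynomial.induction_on with
    | C a =>
      have := isAlgebraic_algebraMap (R := MvPolynomial ι k) (A := C) (MvPolynomial.C a)
      rwa [hmap, aeval_C] at this
    | add q q' h h' => rw [map_add]; exact h.add h'
    | mul_X q t h => rw [map_mul]; exact h.mul (hX t)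
  constructor
  · obtain ⟨f, hf, d, hd⟩ := hasGenericFiberCard_of_finiteType (A := MvPolynomial ι k) (C := C)
      (Ω := k)
    refine ⟨f, hf, d, fun u hu => ?_⟩
    rw [← hd (eval u) hu]
    have hinj : Set.InjOn (fun (ψ : C →+* k) t => ψ (Ideal.Quotient.mk p (X t)))
        {ψ | ψ.comp (algebraMap (MvPolynomial ι k) C) = eval u} := by
      intro ψ hψ ψ' hψ' hh
      have hc : ∀ χ : C →+* k, χ.comp (algebraMap (MvPolynomial ι k) C) = eval u → ∀ a : k,
          χ (Ideal.Quotient.mk p (MvPolynomial.C a)) = a := by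
        intro χ hχ a
        have := RingHom.congr_fun hχ (MvPolynomial.C a)
        rwa [RingHom.comp_apply, hmap, aeval_C, eval_C] at this
      refine Ideal.Quotient.ringHom_ext (MvPolynomial.ringHom_ext (fun a => ?_) fun t => ?_)
      · rw [RingHom.comp_apply, RingHom.comp_apply, hc ψ hψ, hc ψ' hψ']
      · exact congrFun hh t
    rw [← hinj.encard_image]
    congr 1
    ext z
    simp only [Set.mem_image, Set.mem_ofPred_eq]
    constructor
    · intro hz
      refine ⟨Ideal.Quotient.lift p (eval z) hz.1, ?_, ?_⟩
      · ext f
        · rw [RingHom.comp_apply, RingHom.comp_apply, hmap, Ideal.Quotient.lift_mk,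
            eval_aeval_of_mem_systemFiber hz, RingHom.comp_apply]
        · rw [RingHom.comp_apply, hmap, Ideal.Quotient.lift_mk, eval_aeval_of_mem_systemFiber hz]
      · ext t
        exact (Ideal.Quotient.lift_mk _ _ _).trans (eval_X t)
    · rintro ⟨ψ, hψ, rfl⟩
      have hev : ∀ q, eval (fun t => ψ (Ideal.Quotient.mk p (X t))) q =
          ψ (Ideal.Quotient.mk p q) := by
        intro q
        suffices hs : eval (fun t => ψ (Ideal.Quotient.mk p (X t))) =
            ψ.comp (Ideal.Quotient.mk p) by
          rw [hs]; rfl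
        refine MvPolynomial.ringHom_ext (fun a => ?_) fun t => ?_
        · have := RingHom.congr_fun hψ (MvPolynomial.C a)
          rw [RingHom.comp_apply, hmap, aeval_C, eval_C] at this
          rw [eval_C, RingHom.comp_apply]
          exact this.symm
        · simp
      refine ⟨fun q hq => ?_, fun i => ?_⟩
      · rw [hev, Ideal.Quotient.eq_zero_iff_mem.2 hq, map_zero]
      · have := RingHom.congr_fun hψ (X i)
        rw [RingHom.comp_apply, hmap, aeval_X, eval_X] at this
        rw [hev, this]
  · intro y hy
    obtain ⟨a, ha, c, hc⟩ := (hCalg.isAlgebraic (Ideal.Quotient.mk p y)).exists_nonzero_dvd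
      (mem_nonZeroDivisors_of_ne_zero (by rwa [Ne, Ideal.Quotient.eq_zero_iff_mem]))
    obtain ⟨c, rfl⟩ := Ideal.Quotient.mk_surjective c
    refine ⟨a, ha, c, ?_⟩
    rw [← Ideal.Quotient.eq_zero_iff_mem, map_sub, map_mul, ← hc, hmap, sub_self]

theorem exists_minimalPrime_mem_systemFiber {E : Set (MvPolynomial τ k)}
    {φ : ι → MvPolynomial τ k} {u : ι → k} {z : τ → k} (hz : z ∈ systemFiber E φ u) :
    ∃ p ∈ (Ideal.span E).minimalPrimes, z ∈ systemFiber (p : Set (MvPolynomial τ k)) φ u := by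
  have := isPrime_ker_eval z
  obtain ⟨p, hp, hle⟩ := Ideal.exists_minimalPrimes_le
    (I := Ideal.span E) (J := RingHom.ker (eval z)) (Ideal.span_le.2 hz.1)
  exact ⟨p, hp, fun q hq => hle hq, hz.2⟩

/-- If no zero of `E` in an extension field has an algebraically independent `φ`-image, then
the general fibre of the zero set of `E` is empty. -/
theorem exists_systemFiber_eq_empty [Finite τ] (E : Set (MvPolynomial τ k))
    (φ : ι → MvPolynomial τ k)
    (hE : ∀ (L : Type) [Field L] [Algebra k L] (z : τ → L), (∀ p ∈ E, aeval z p = 0) →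
      ¬ AlgebraicIndependent k fun i => aeval z (φ i)) :
    ∃ f : MvPolynomial ι k, f ≠ 0 ∧ ∀ u : ι → k, eval u f ≠ 0 → systemFiber E φ u = ∅ := by
  have hfin := (Ideal.span E).finite_minimalPrimes_of_isNoetherianRing
  -- No component dominates the base, since its generic point would contradict `hE`. Thus each
  -- component lies over a proper hypersurface `f = 0`.
  have hp : ∀ p : Ideal (MvPolynomial τ k), ∃ f : MvPolynomial ι k, f ≠ 0 ∧
      (p ∈ (Ideal.span E).minimalPrimes → aeval φ f ∈ p) := by
    intro p
    by_cases hmem : p ∈ (Ideal.span E).minimalPrimes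
    · have : p.IsPrime := hmem.1.1
      by_contra! hcon
      refine hE _ (genericPoint p) (fun q hq => (aeval_genericPoint_eq_zero p).2
        (hmem.1.2 (Ideal.subset_span hq))) (algebraicIndependent_genericPoint p fun f hf => ?_)
      by_contra hf0
      exact (hcon f hf0).2 hf
    · exact ⟨1, one_ne_zero, fun h => (hmem h).elim⟩
  choose f hf0 hf using hp
  refine ⟨∏ p ∈ hfin.toFinset, f p, Finset.prod_ne_zero_iff.2 fun p _ => hf0 p, fun u hu => ?_⟩
  rw [Set.eq_empty_iff_forall_notMem]
  intro z hz
  obtain ⟨p, hp, hzp⟩ := exists_minimalPrime_mem_systemFiber hz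
  rw [map_prod, Finset.prod_ne_zero_iff] at hu
  refine hu p (hfin.mem_toFinset.2 hp) ?_
  rw [← eval_aeval_of_mem_systemFiber hzp]
  exact hzp.1 _ (hf p hp)

/-- If all zeros of `E` in extension fields with algebraically independent `φ`-image are
algebraic over that image, then the general fibre of the zero set of `E` has a constant finite
number of points. -/
theorem exists_systemFiber_encard [Finite τ] [IsAlgClosed k] [CharZero k]
    (E : Set (MvPolynomial τ k)) (φ : ι → MvPolynomial τ k)
    (hE : ∀ (L : Type) [Field L] [Algebra k L] (z : τ → L), (∀ p ∈ E, aeval z p = 0) →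
      (AlgebraicIndependent k fun i => aeval z (φ i)) →
      ∀ t, IsAlgebraic (Algebra.adjoin k (Set.range fun i => aeval z (φ i))) (z t)) :
    ∃ f : MvPolynomial ι k, f ≠ 0 ∧ ∃ d : ℕ, ∀ u : ι → k, eval u f ≠ 0 →
      (systemFiber E φ u).encard = d := by
  classical
  have hfin := (Ideal.span E).finite_minimalPrimes_of_isNoetherianRing
  have hdom : ∀ p ∈ (Ideal.span E).minimalPrimes, ∀ _ : p.IsPrime,
      (∀ f : MvPolynomial ι k, aeval φ f ∈ p → f = 0) →
      ∀ t, IsAlgebraic (Algebra.adjoin k (Set.range fun i => aeval (genericPoint p) (φ i)))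
        (genericPoint p t) := fun p hp _ h =>
    hE _ (genericPoint p) (fun q hq => (aeval_genericPoint_eq_zero p).2
      (hp.1.2 (Ideal.subset_span hq))) (algebraicIndependent_genericPoint p h)
  have hcard : ∀ p : Ideal (MvPolynomial τ k), ∃ f : MvPolynomial ι k, f ≠ 0 ∧ ∃ d : ℕ,
      p ∈ (Ideal.span E).minimalPrimes → ∀ u : ι → k, eval u f ≠ 0 →
        (systemFiber (p : Set (MvPolynomial τ k)) φ u).encard = d := by
    intro p
    by_cases hmem : p ∈ (Ideal.span E).minimalPrimes
    · have hprime : p.IsPrime := hmem.1.1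
      by_cases h : ∀ f : MvPolynomial ι k, aeval φ f ∈ p → f = 0
      · obtain ⟨f, hf, d, hd⟩ := (prime_fiber_card p h (hdom p hmem hprime h)).1
        exact ⟨f, hf, d, fun _ => hd⟩
      · push Not at h
        obtain ⟨f, hfp, hf⟩ := h
        refine ⟨f, hf, 0, fun _ u hu => ?_⟩
        rw [Nat.cast_zero, Set.encard_eq_zero, Set.eq_empty_iff_forall_notMem]
        intro z hz
        exact hu (eval_aeval_of_mem_systemFiber hz f ▸ hz.1 _ hfp)
    · exact ⟨1, one_ne_zero, 0, fun h => (hmem h).elim⟩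
  -- Distinct components meet only over a proper hypersurface: some `y` vanishes on the second but
  -- not on the first, and either the first does not dominate the base or `y` divides a nonzero
  -- element of the base modulo `p`.
  have hdisj : ∀ p q : Ideal (MvPolynomial τ k), ∃ f : MvPolynomial ι k, f ≠ 0 ∧
      (p ∈ (Ideal.span E).minimalPrimes → q ∈ (Ideal.span E).minimalPrimes → p ≠ q →
        ∀ u : ι → k, eval u f ≠ 0 →
          Disjoint (systemFiber (p : Set (MvPolynomial τ k)) φ u)
            (systemFiber (q : Set (MvPolynomial τ k)) φ u)) := by
    intro p q
    by_cases hpq : p ∈ (Ideal.span E).minimalPrimes ∧ q ∈ (Ideal.span E).minimalPrimes ∧ p ≠ q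
    · obtain ⟨hp, hq, hne⟩ := hpq
      have hprime : p.IsPrime := hp.1.1
      have hqp : ¬ q ≤ p := fun hle => hne (le_antisymm (hp.2 hq.1 hle) hle)
      obtain ⟨y, hyq, hyp⟩ := SetLike.not_le_iff_exists.1 hqp
      have hex : ∃ a : MvPolynomial ι k, a ≠ 0 ∧ ∃ c, aeval φ a - y * c ∈ p := by
        by_cases h : ∀ f : MvPolynomial ι k, aeval φ f ∈ p → f = 0
        · exact (prime_fiber_card p h (hdom p hp hprime h)).2 y hyp
        · push Not at h
          obtain ⟨f, hfp, hf⟩ := h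
          exact ⟨f, hf, 0, by simpa using hfp⟩
      obtain ⟨a, ha, c, hac⟩ := hex
      refine ⟨a, ha, fun _ _ _ u hu => Set.disjoint_left.2 fun z hzp hzq => hu ?_⟩
      have h1 := hzp.1 _ hac
      rw [map_sub, map_mul, hzq.1 y hyq, zero_mul, sub_zero,
        eval_aeval_of_mem_systemFiber hzp] at h1
      exact h1
    · exact ⟨1, one_ne_zero, fun h1 h2 h3 => (hpq ⟨h1, h2, h3⟩).elim⟩
  choose f hf0 d hf using hcard
  choose g hg0 hg using hdisj
  refine ⟨(∏ p ∈ hfin.toFinset, f p) * ∏ p ∈ hfin.toFinset, ∏ q ∈ hfin.toFinset, g p q,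
    mul_ne_zero (Finset.prod_ne_zero_iff.2 fun p _ => hf0 p)
      (Finset.prod_ne_zero_iff.2 fun p _ => Finset.prod_ne_zero_iff.2 fun q _ => hg0 p q),
    ∑ p ∈ hfin.toFinset, d p, fun u hu => ?_⟩
  rw [map_mul, map_prod, map_prod] at hu
  have hu1 := Finset.prod_ne_zero_iff.1 (left_ne_zero_of_mul hu)
  have hu2 := Finset.prod_ne_zero_iff.1 (right_ne_zero_of_mul hu)
  have hU : systemFiber E φ u =
      ⋃ p ∈ hfin.toFinset, systemFiber (p : Set (MvPolynomial τ k)) φ u := by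
    ext z
    simp only [Set.mem_iUnion, hfin.mem_toFinset, exists_prop]
    refine ⟨exists_minimalPrime_mem_systemFiber, ?_⟩
    rintro ⟨p, hp, hz⟩
    exact ⟨fun q hq => hz.1 q (hp.1.2 (Ideal.subset_span hq)), hz.2⟩
  rw [hU, encard_biUnion_finset _ _ d]
  · exact fun p hp => hf p (hfin.mem_toFinset.1 hp) u (hu1 p hp)
  · intro p hp q hq hne
    have h := hu2 p hp
    rw [map_prod] at h
    exact hg p q (hfin.mem_toFinset.1 hp) (hfin.mem_toFinset.1 hq) hne u
      (Finset.prod_ne_zero_iff.1 h q hq)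

end PolynomialSystems

/-! ### Tangent spaces -/

section Tangent

variable {m : ℕ}

theorem hasDerivAt_evalMatrix (f : MvPolynomial (Fin m × Fin m) ℂ)
    {γ : ℂ → Matrix (Fin m) (Fin m) ℂ} {V : Matrix (Fin m) (Fin m) ℂ} {a : ℂ}
    (hγ : ∀ i j, HasDerivAt (fun t => γ t i j) (V i j) a) :
    HasDerivAt (fun t => evalMatrix (γ t) f)
      (∑ i, ∑ j, V i j * evalMatrix (γ a) (MvPolynomial.pderiv (i, j) f)) a := by
  induction f using MvPolynomial.induction_on with
  | C c => simpa [evalMatrix] using hasDerivAt_const a c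
  | add p q hp hq =>
    refine (hp.add hq).congr_deriv ?_ |>.congr_of_eventuallyEq (Filter.Eventually.of_forall ?_)
    · simp [evalMatrix, mul_add, Finset.sum_add_distrib]
    · intro t; simp [evalMatrix]
  | mul_X p n hp =>
    refine (hp.mul (hγ n.1 n.2)).congr_deriv ?_ |>.congr_of_eventuallyEq
      (Filter.Eventually.of_forall ?_)
    · have h : ∀ i j, V i j * evalMatrix (γ a) (MvPolynomial.pderiv (i, j)
          (p * MvPolynomial.X n)) =
          V i j * evalMatrix (γ a) (MvPolynomial.pderiv (i, j) p) * γ a n.1 n.2 +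
          (if i = n.1 then if j = n.2 then V i j * evalMatrix (γ a) p else 0 else 0) := by
        intro i j
        obtain ⟨n1, n2⟩ := n
        simp only [evalMatrix, MvPolynomial.pderiv_mul, MvPolynomial.pderiv_X, map_add, map_mul,
          MvPolynomial.eval_X, Pi.single_apply, Prod.mk.injEq, ← ite_and]
        by_cases hij : i = n1 ∧ j = n2
        · obtain ⟨rfl, rfl⟩ := hij
          simp; ring
        · have hij' : ¬ (n1 = i ∧ n2 = j) := fun h => hij ⟨h.1.symm, h.2.symm⟩
          simp [hij, hij']; ring
      simp only [h, Finset.sum_add_distrib, ← Finset.sum_mul]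
      congr 1
      rw [Finset.sum_eq_single n.1, Finset.sum_eq_single n.2]
      · simp [mul_comm]
      · intro j _ hj; simp [hj]
      · simp
      · intro i _ hi; simp [hi]
      · simp
    · intro t; simp [evalMatrix]

/-- The velocity of a curve in `X` is a tangent vector. -/
theorem mem_tangentSpace_of_curve {X : Set (Matrix (Fin m) (Fin m) ℂ)}
    {γ : ℂ → Matrix (Fin m) (Fin m) ℂ} {V P : Matrix (Fin m) (Fin m) ℂ}
    (hγ : ∀ i j, HasDerivAt (fun t => γ t i j) (V i j) 0) (h0 : γ 0 = P)
    (hX : ∀ᶠ t in nhds 0, γ t ∈ X) : V ∈ tangentSpace X P := by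
  intro f hf
  have h1 := hasDerivAt_evalMatrix f hγ
  have h2 : HasDerivAt (fun t => evalMatrix (γ t) f) 0 0 :=
    (hasDerivAt_const (0 : ℂ) (0 : ℂ)).congr_of_eventuallyEq (hX.mono fun t ht => hf _ ht)
  rw [← h0]
  exact h1.unique h2

theorem deriv_eq_zero_of_mem_tangentSpace {X : Set (Matrix (Fin m) (Fin m) ℂ)}
    {V P : Matrix (Fin m) (Fin m) ℂ} (hV : V ∈ tangentSpace X P)
    {f : MvPolynomial (Fin m × Fin m) ℂ} (hf : ∀ Y ∈ X, evalMatrix Y f = 0) {d : ℂ}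
    (hd : HasDerivAt (fun t : ℂ => evalMatrix (P + t • V) f) d 0) : d = 0 := by
  have h1 := hasDerivAt_evalMatrix f (γ := fun t : ℂ => P + t • V) (V := V) (a := 0) fun i j => by
    simpa using ((hasDerivAt_id (0 : ℂ)).mul_const (V i j)).const_add (P i j)
  have h2 := hV f hf
  rw [← h2]
  refine hd.unique ?_
  simpa using h1

theorem skew_of_mem_tangentSpace {X : Set (Matrix (Fin m) (Fin m) ℂ)}
    (hX : ∀ Y ∈ X, Yᵀ = -Y) {V P : Matrix (Fin m) (Fin m) ℂ} (hV : V ∈ tangentSpace X P)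
    (hP : P ∈ X) : Vᵀ = -V := by
  ext i j
  have h := deriv_eq_zero_of_mem_tangentSpace hV
    (f := MvPolynomial.X (j, i) + MvPolynomial.X (i, j)) (d := V j i + V i j)
    (fun Y hY => by simp [evalMatrix, skew_apply (hX Y hY) j i]) (by
      have hPs := skew_apply (hX P hP) j i
      have : (fun t : ℂ => evalMatrix (P + t • V)
          (MvPolynomial.X (j, i) + MvPolynomial.X (i, j))) =
          fun t => t * (V j i + V i j) := by
        funext t
        simp [evalMatrix, hPs]; ring
      rw [this]
      simpa using (hasDerivAt_id (0 : ℂ)).mul_const (V j i + V i j))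
  rw [Matrix.transpose_apply, Matrix.neg_apply]
  linear_combination h

theorem upperSum_add_smul (P V : Matrix (Fin m) (Fin m) ℂ) (t : ℂ) :
    upperSum (P + t • V) = upperSum P + t * upperSum V := by
  simp [upperSum, Finset.sum_add_distrib, Finset.mul_sum]

theorem upperSum_of_mem_tangentSpace {X : Set (Matrix (Fin m) (Fin m) ℂ)} {c : ℂ}
    (hX : ∀ Y ∈ X, upperSum Y = c) {V P : Matrix (Fin m) (Fin m) ℂ} (hV : V ∈ tangentSpace X P) :
    upperSum V = 0 := by
  have hev : ∀ Y : Matrix (Fin m) (Fin m) ℂ, evalMatrix Y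
      ((∑ i, ∑ j ∈ Finset.Ioi i, MvPolynomial.X (i, j)) - MvPolynomial.C c) = upperSum Y - c := by
    intro Y; simp [evalMatrix, upperSum]
  refine deriv_eq_zero_of_mem_tangentSpace hV (fun Y hY => by rw [hev, hX Y hY, sub_self]) ?_
  simp only [hev, upperSum_add_smul]
  simpa using (((hasDerivAt_id (0 : ℂ)).mul_const (upperSum V)).const_add (upperSum P)).sub_const c

/-- A matrix has an inner inverse, and an invertible compression of the size of its rank. -/
theorem exists_inner_inverse_and_compression {n F : Type*} [Field F] [Fintype n] [DecidableEq n]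
    (M : Matrix n n F) :
    (∃ G, M * G * M = M) ∧ ∃ (A : Matrix (Fin M.rank) n F) (B : Matrix n (Fin M.rank) F),
      A * M * B = 1 := by
  obtain ⟨V, U, e, hV, hU, h⟩ := M.exists_rank_normal_form
  set D : Matrix (Fin M.rank ⊕ Fin (Fintype.card n - M.rank))
    (Fin M.rank ⊕ Fin (Fintype.card n - M.rank)) F := Matrix.fromBlocks 1 0 0 0 with hD
  constructor
  · refine ⟨U * V, ?_⟩
    have hDD : D.submatrix e e * D.submatrix e e = D.submatrix e e := by
      rw [Matrix.submatrix_mul_equiv, hD, Matrix.fromBlocks_multiply]; simp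
    refine hV.mul_left_cancel (hU.mul_right_cancel ?_)
    calc V * (M * (U * V) * M) * U = (V * M * U) * (V * M * U) := by simp only [Matrix.mul_assoc]
      _ = V * M * U := by rw [h, hDD]
  · refine ⟨V.submatrix (e.symm ∘ Sum.inl) id, U.submatrix id (e.symm ∘ Sum.inl), ?_⟩
    have : V.submatrix (e.symm ∘ Sum.inl) id * M * U.submatrix id (e.symm ∘ Sum.inl) =
      (V * M * U).submatrix (e.symm ∘ Sum.inl) (e.symm ∘ Sum.inl) := rfl
    rw [this, h]
    ext i j
    simp [hD]

/-- A tangent vector to a variety of matrices of bounded rank vanishes on the left and right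
kernel. -/
theorem dotProduct_mulVec_eq_zero_of_mem_tangentSpace {X : Set (Matrix (Fin m) (Fin m) ℂ)}
    {A M V P : Matrix (Fin m) (Fin m) ℂ} {c : ℂ} (hc : c ≠ 0)
    (hX : ∀ Y ∈ X, (A + c • Y).rank ≤ M.rank) (hM : M = A + c • P) (hV : V ∈ tangentSpace X P)
    {x y : Fin m → ℂ} (hx : x ᵥ* M = 0) (hy : M *ᵥ y = 0) : x ⬝ᵥ V *ᵥ y = 0 := by
  obtain ⟨F₀, G₀, hFG⟩ := (exists_inner_inverse_and_compression M).2
  -- Border an invertible compression of `M` by the kernel vectors `x` and `y`. The resulting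
  -- determinant `f` has size one larger than the rank, so it vanishes on `X`.
  set F : Matrix (Fin M.rank ⊕ Unit) (Fin m) ℂ :=
    Matrix.fromRows F₀ (Matrix.replicateRow Unit x) with hF
  set G : Matrix (Fin m) (Fin M.rank ⊕ Unit) ℂ :=
    Matrix.fromCols G₀ (Matrix.replicateCol Unit y) with hG
  set N : Matrix (Fin m) (Fin m) (MvPolynomial (Fin m × Fin m) ℂ) :=
    Matrix.of fun i j => MvPolynomial.C (A i j) + MvPolynomial.C c * MvPolynomial.X (i, j) with hN
  set f : MvPolynomial (Fin m × Fin m) ℂ :=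
    (F.map (MvPolynomial.C (σ := Fin m × Fin m)) * N *
      G.map (MvPolynomial.C (σ := Fin m × Fin m))).det with hf
  have hev : ∀ Y : Matrix (Fin m) (Fin m) ℂ, evalMatrix Y f = (F * (A + c • Y) * G).det := by
    intro Y
    rw [evalMatrix, hf, RingHom.map_det, RingHom.mapMatrix_apply, Matrix.map_mul, Matrix.map_mul]
    congr 3
    · ext; simp
    · ext; simp [hN]
    · ext; simp
  have hvan : ∀ Y ∈ X, evalMatrix Y f = 0 := by
    intro Y hY
    rw [hev]
    by_contra hne
    have h1 := Matrix.rank_of_isUnit _ ((Matrix.isUnit_iff_isUnit_det _).2 (Ne.isUnit hne))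
    have h2 := (Matrix.rank_mul_le_left (F * (A + c • Y)) G).trans
      (Matrix.rank_mul_le_right F (A + c • Y))
    have h3 := hX Y hY
    rw [h1] at h2
    simp at h2
    omega
  have hMy : M * Matrix.replicateCol Unit y = 0 := by
    ext i j; exact congrFun hy i
  have hxM : Matrix.replicateRow Unit x * M = 0 := by
    ext i j; exact congrFun hx j
  -- The last block row of the bordered matrix at `P + t • V` is divisible by `t`. With this factor
  -- removed, `K 0` is block triangular with determinant `c` times `x ⬝ᵥ V *ᵥ y`, which is the
  -- derivative of `f` along `V`.
  set K : ℂ → Matrix (Fin M.rank ⊕ Unit) (Fin M.rank ⊕ Unit) ℂ := fun t =>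
    Matrix.fromBlocks (1 + t • (c • (F₀ * V * G₀)))
      (t • (c • (F₀ * V * Matrix.replicateCol Unit y)))
      (c • (Matrix.replicateRow Unit x * V * G₀))
      (c • (Matrix.replicateRow Unit x * V * Matrix.replicateCol Unit y)) with hK
  have hblock : ∀ t : ℂ, evalMatrix (P + t • V) f = t * (K t).det := by
    intro t
    have h1 : F * (A + c • (P + t • V)) * G = Matrix.fromBlocks 1 0 0 (t • 1) * K t := by
      have e1 : A + c • (P + t • V) = M + t • (c • V) := by
        rw [hM, smul_add, smul_comm c t, add_assoc]
      rw [e1, hF, hG, Matrix.fromRows_mul, Matrix.fromRows_mul_fromCols, hK,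
        Matrix.fromBlocks_multiply]
      congr 1
      · simp only [Matrix.mul_add, Matrix.add_mul, hFG, Matrix.mul_smul, Matrix.smul_mul,
          Matrix.one_mul, Matrix.zero_mul, smul_zero, add_zero]
      · simp only [Matrix.mul_add, Matrix.add_mul, Matrix.mul_smul, Matrix.smul_mul,
          Matrix.one_mul, Matrix.zero_mul, add_zero, Matrix.mul_assoc F₀ M, hMy, Matrix.mul_zero,
          zero_add, smul_zero]
      · simp only [Matrix.mul_add, Matrix.mul_smul, Matrix.smul_mul,
          Matrix.one_mul, Matrix.zero_mul, hxM, smul_zero, zero_add, smul_comm t c]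
      · simp only [Matrix.mul_add, Matrix.mul_smul, Matrix.smul_mul,
          Matrix.one_mul, Matrix.zero_mul, hxM, smul_zero, zero_add, smul_comm t c]
    rw [hev, h1, Matrix.det_mul, Matrix.det_fromBlocks_zero₂₁]
    simp
  have hcont : Continuous fun t => (K t).det := by
    refine Continuous.matrix_det (Continuous.matrix_fromBlocks ?_ ?_ ?_ ?_) <;> fun_prop
  have hderiv : HasDerivAt (fun t : ℂ => evalMatrix (P + t • V) f) (K 0).det 0 := by
    rw [hasDerivAt_iff_tendsto_slope]
    refine ((hcont.tendsto 0).mono_left nhdsWithin_le_nhds).congr' ?_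
    filter_upwards [self_mem_nhdsWithin] with t ht
    rw [slope_def_field, hblock, hblock, zero_mul, sub_zero, sub_zero,
      mul_div_cancel_left₀ _ ht]
  have h0 := deriv_eq_zero_of_mem_tangentSpace hV hvan hderiv
  simp only [hK, zero_smul, add_zero] at h0
  rw [Matrix.det_fromBlocks_zero₁₂, Matrix.det_one, one_mul, Matrix.det_unique] at h0
  have h2 : (Matrix.replicateRow Unit x * V * Matrix.replicateCol Unit y) default default =
      x ⬝ᵥ V *ᵥ y := by
    rw [Matrix.mul_assoc]; rfl
  rw [Matrix.smul_apply, h2, smul_eq_mul] at h0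
  exact (mul_eq_zero.1 h0).resolve_left hc

/-- Rows and columns of `W` lie in the left and right kernels of `M`, so `W * V * W = 0`. Writing `W
= W * G * W` and rotating the trace exposes this product. -/
theorem trace_mul_eq_zero_of_mem_tangentSpace {X : Set (Matrix (Fin m) (Fin m) ℂ)}
    {A M V P W : Matrix (Fin m) (Fin m) ℂ} {c : ℂ} (hc : c ≠ 0)
    (hX : ∀ Y ∈ X, (A + c • Y).rank ≤ M.rank) (hM : M = A + c • P) (hV : V ∈ tangentSpace X P)
    (hMW : M * W = 0) (hWM : W * M = 0) : (V * W).trace = 0 := by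
  have hWVW : W * V * W = 0 := by
    ext i j
    have := dotProduct_mulVec_eq_zero_of_mem_tangentSpace hc hX hM hV (x := W i)
      (y := fun k => W k j) (funext fun k => congrFun (congrFun hWM i) k)
      (funext fun k => congrFun (congrFun hMW k) j)
    rw [Matrix.mul_assoc]
    exact this
  obtain ⟨G, hG⟩ := (exists_inner_inverse_and_compression W).1
  rw [← hG, ← Matrix.mul_assoc, Matrix.trace_mul_comm, ← Matrix.mul_assoc, ← Matrix.mul_assoc,
    hWVW, Matrix.zero_mul, Matrix.trace_zero]

end Tangent

/-! ### Critical points -/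

section Critical

variable {m : ℕ}

theorem upperSum_eq_sum_ite (A : Matrix (Fin m) (Fin m) ℂ) :
    upperSum A = ∑ i, ∑ j, if i < j then A i j else 0 := by
  refine Finset.sum_congr rfl fun i _ => ?_
  rw [← Finset.sum_filter]
  refine Finset.sum_congr ?_ fun _ _ => rfl
  ext j; simp

theorem totalSum_eq_two_mul_upperSum {A : Matrix (Fin m) (Fin m) ℂ} (hA : Aᵀ = A)
    (h0 : ∀ i, A i i = 0) : totalSum A = 2 * upperSum A := by
  have hu := upperSum_eq_sum_ite A
  have hu' : upperSum A = ∑ i, ∑ j, if j < i then A i j else 0 := by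
    rw [hu, Finset.sum_comm]
    refine Finset.sum_congr rfl fun i _ => Finset.sum_congr rfl fun j _ => ?_
    rw [show A j i = A i j from congrFun (congrFun hA i) j]
  rw [two_mul]
  nth_rewrite 1 [hu]
  rw [hu', ← Finset.sum_add_distrib]
  refine Finset.sum_congr rfl fun i _ => ?_
  rw [← Finset.sum_add_distrib]
  refine Finset.sum_congr rfl fun j _ => ?_
  rcases lt_trichotomy i j with h | rfl | h
  · simp [h, h.not_gt]
  · simp [h0]
  · simp [h, h.not_gt]

/-- The entrywise pairing of skew matrices is a trace form. -/
theorem trace_mul_of_skew {V W : Matrix (Fin m) (Fin m) ℂ} (hV : Vᵀ = -V) (hW : Wᵀ = -W) :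
    (V * W).trace = -2 * upperSum (V ⊙ W) := by
  have h : totalSum (V ⊙ W) = 2 * upperSum (V ⊙ W) := by
    refine totalSum_eq_two_mul_upperSum ?_ fun i => ?_
    · ext i j
      rw [Matrix.transpose_apply, Matrix.hadamard_apply, Matrix.hadamard_apply, skew_apply hV,
        skew_apply hW, neg_mul_neg]
    · rw [Matrix.hadamard_apply, skew_apply_self hV, zero_mul]
  have h' : (V * W).trace = -totalSum (V ⊙ W) := by
    rw [Matrix.trace, totalSum, ← Finset.sum_neg_distrib]
    refine Finset.sum_congr rfl fun i _ => ?_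
    rw [Matrix.diag_apply, Matrix.mul_apply, ← Finset.sum_neg_distrib]
    refine Finset.sum_congr rfl fun j _ => ?_
    rw [Matrix.hadamard_apply, skew_apply hW j i, mul_neg]
  rw [h', h]; ring

/-- By skewness the two summands contribute equally to the trace against `W`, so the hypothesis says
that `A * (M * W)` has trace zero for every `A`. -/
theorem mul_eq_zero_of_forall_upperSum {M W : Matrix (Fin m) (Fin m) ℂ} (hM : Mᵀ = -M)
    (hW : Wᵀ = -W) (h : ∀ A : Matrix (Fin m) (Fin m) ℂ, upperSum ((A * M + M * Aᵀ) ⊙ W) = 0) :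
    M * W = 0 := by
  have hskew : ∀ A : Matrix (Fin m) (Fin m) ℂ, (A * M + M * Aᵀ)ᵀ = -(A * M + M * Aᵀ) := by
    intro A
    simp only [Matrix.transpose_add, Matrix.transpose_mul, Matrix.transpose_transpose, hM,
      Matrix.neg_mul, Matrix.mul_neg]
    abel
  have htr : ∀ A : Matrix (Fin m) (Fin m) ℂ, (A * (M * W)).trace = 0 := by
    intro A
    have h1 := trace_mul_of_skew (hskew A) hW
    rw [h A, mul_zero, Matrix.add_mul, Matrix.trace_add] at h1
    have h2 : (M * Aᵀ * W).trace = (A * M * W).trace := by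
      rw [← Matrix.trace_transpose]
      simp only [Matrix.transpose_mul, Matrix.transpose_transpose, hM, hW, Matrix.neg_mul,
        Matrix.mul_neg, neg_neg]
      rw [Matrix.trace_mul_comm]
    rw [h2, ← two_mul, Matrix.mul_assoc] at h1
    simpa using h1
  ext i j
  have := htr (Matrix.single j i 1)
  rw [Matrix.trace_single_mul] at this
  simpa using this

theorem skewOnes_skew : (skewOnes m)ᵀ = -skewOnes m := by
  ext i j
  rw [Matrix.transpose_apply, Matrix.neg_apply, skewOnes, Matrix.of_apply, Matrix.of_apply]
  rcases lt_trichotomy i j with h | rfl | h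
  · simp [h, h.not_gt]
  · simp
  · simp [h, h.not_gt]

theorem upperSum_congr {A B : Matrix (Fin m) (Fin m) ℂ} (h : ∀ i j, i < j → A i j = B i j) :
    upperSum A = upperSum B :=
  Finset.sum_congr rfl fun i _ => Finset.sum_congr rfl fun j hj => h i j (Finset.mem_Ioi.1 hj)

theorem upperSum_hadamard_skewOnes (V : Matrix (Fin m) (Fin m) ℂ) :
    upperSum (V ⊙ skewOnes m) = upperSum V :=
  upperSum_congr fun i j h => by simp [skewOnes, h]

theorem upperSum_sub (A B : Matrix (Fin m) (Fin m) ℂ) :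
    upperSum (A - B) = upperSum A - upperSum B := by
  simp [upperSum]

theorem upperSum_smul (c : ℂ) (A : Matrix (Fin m) (Fin m) ℂ) :
    upperSum (c • A) = c * upperSum A := by
  simp [upperSum, Finset.mul_sum]

theorem entrywiseQuotient_skew {U P : Matrix (Fin m) (Fin m) ℂ} (hU : U ∈ dataMatrices m)
    (hP : Pᵀ = -P) : (entrywiseQuotient U P)ᵀ = -entrywiseQuotient U P := by
  ext i j
  rw [Matrix.transpose_apply, Matrix.neg_apply, entrywiseQuotient, Matrix.of_apply,
    Matrix.of_apply, skew_apply hP j i, show U j i = U i j from congrFun (congrFun hU.1 i) j,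
    div_neg]

theorem sum_log_derivative (U P V : Matrix (Fin m) (Fin m) ℂ) :
    ∑ i, ∑ j ∈ Finset.Ioi i, V i j * U i j / P i j = upperSum (V ⊙ entrywiseQuotient U P) := by
  simp only [upperSum, Matrix.hadamard_apply, entrywiseQuotient, Matrix.of_apply, mul_div_assoc]

theorem mul_eq_zero_comm_of_skew {M W : Matrix (Fin m) (Fin m) ℂ} (hM : Mᵀ = -M)
    (hW : Wᵀ = -W) (h : M * W = 0) : W * M = 0 := by
  have := congrArg Matrix.transpose h
  simpa [Matrix.transpose_mul, hM, hW] using this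

/-- The curve of matrices congruent to `M` with velocity `A * M + M * Aᵀ`. -/
noncomputable def congruenceCurve (A M : Matrix (Fin m) (Fin m) ℂ) (t : ℂ) :
    Matrix (Fin m) (Fin m) ℂ :=
  (1 + t • A) * M * (1 + t • A)ᵀ

theorem congruenceCurve_eq (A M : Matrix (Fin m) (Fin m) ℂ) (t : ℂ) :
    congruenceCurve A M t = M + t • (A * M + M * Aᵀ) + (t * t) • (A * M * Aᵀ) := by
  rw [congruenceCurve, Matrix.transpose_add, Matrix.transpose_one, Matrix.transpose_smul]
  simp only [Matrix.add_mul, Matrix.mul_add, Matrix.one_mul, Matrix.mul_one, Matrix.smul_mul,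
    Matrix.mul_smul, smul_add, smul_smul]
  abel

theorem congruenceCurve_zero (A M : Matrix (Fin m) (Fin m) ℂ) : congruenceCurve A M 0 = M := by
  simp [congruenceCurve]

theorem congruenceCurve_skew (A : Matrix (Fin m) (Fin m) ℂ) {M : Matrix (Fin m) (Fin m) ℂ}
    (hM : Mᵀ = -M) (t : ℂ) : (congruenceCurve A M t)ᵀ = -congruenceCurve A M t := by
  simp only [congruenceCurve, Matrix.transpose_mul, Matrix.transpose_transpose, hM,
    Matrix.neg_mul, Matrix.mul_neg, Matrix.mul_assoc]

theorem hasDerivAt_congruenceCurve (A M : Matrix (Fin m) (Fin m) ℂ) (i j : Fin m) :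
    HasDerivAt (fun t => congruenceCurve A M t i j) ((A * M + M * Aᵀ) i j) 0 := by
  simp only [congruenceCurve_eq]
  have h := (((hasDerivAt_id (0 : ℂ)).mul_const ((A * M + M * Aᵀ) i j)).const_add (M i j)).add
    (((hasDerivAt_id (0 : ℂ)).mul (hasDerivAt_id (0 : ℂ))).mul_const ((A * M * Aᵀ) i j))
  refine (h.congr_deriv ?_).congr_of_eventuallyEq (Filter.Eventually.of_forall fun t => ?_)
  · simp
  · simp only [Matrix.add_apply, Matrix.smul_apply, smul_eq_mul, Pi.add_apply, Pi.mul_apply, id]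

theorem rank_congruenceCurve (A M : Matrix (Fin m) (Fin m) ℂ) :
    ∀ᶠ t in nhds (0 : ℂ), (congruenceCurve A M t).rank = M.rank := by
  have hc : Continuous fun t : ℂ => (1 + t • A).det := by
    refine Continuous.matrix_det ?_; fun_prop
  have h0 : (1 + (0 : ℂ) • A).det ≠ 0 := by simp
  filter_upwards [hc.continuousAt.eventually_ne h0] with t ht
  rw [congruenceCurve, Matrix.rank_mul_eq_left_of_det_ne_zero _ _ (by rwa [Matrix.det_transpose]),
    Matrix.rank_mul_eq_right_of_det_ne_zero _ _ ht]

theorem hasDerivAt_upperSum {γ : ℂ → Matrix (Fin m) (Fin m) ℂ} {V : Matrix (Fin m) (Fin m) ℂ}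
    {a : ℂ} (hγ : ∀ i j, HasDerivAt (fun t => γ t i j) (V i j) a) :
    HasDerivAt (fun t => upperSum (γ t)) (upperSum V) a := by
  unfold upperSum
  exact HasDerivAt.fun_sum fun i _ => HasDerivAt.fun_sum fun j _ => hγ i j

theorem eventually_entries_ne_zero {γ : ℂ → Matrix (Fin m) (Fin m) ℂ}
    {V : Matrix (Fin m) (Fin m) ℂ} (hγ : ∀ i j, HasDerivAt (fun t => γ t i j) (V i j) 0)
    (h0 : ∀ i j, i < j → γ 0 i j ≠ 0) : ∀ᶠ t in nhds (0 : ℂ), ∀ i j, i < j → γ t i j ≠ 0 := by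
  simp only [Filter.eventually_all]
  exact fun i j hij => (hγ i j).continuousAt.eventually_ne (h0 i j hij)

/-- The likelihood equations on `AM m r`. -/
theorem mem_criticalPoints_AM_iff {r : ℕ} {U P : Matrix (Fin m) (Fin m) ℂ}
    (hU : U ∈ dataMatrices m) (hP : P ∈ AM m r) :
    P ∈ criticalPoints U (AM m r) ↔
      P * (entrywiseQuotient U P - (totalSum U / 2) • skewOnes m) = 0 := by
  obtain ⟨hskew, hsum, hrank, hne⟩ := id hP
  have hQ := entrywiseQuotient_skew hU hskew
  set Q := entrywiseQuotient U P with hQdef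
  have hW : (Q - (totalSum U / 2) • skewOnes m)ᵀ = -(Q - (totalSum U / 2) • skewOnes m) := by
    rw [Matrix.transpose_sub, Matrix.transpose_smul, hQ, skewOnes_skew]
    simp only [smul_neg]; abel
  have hpair : ∀ V : Matrix (Fin m) (Fin m) ℂ,
      upperSum (V ⊙ (Q - (totalSum U / 2) • skewOnes m)) =
        upperSum (V ⊙ Q) - totalSum U / 2 * upperSum V := by
    intro V
    have hsub : V ⊙ (Q - (totalSum U / 2) • skewOnes m) =
        V ⊙ Q - V ⊙ ((totalSum U / 2) • skewOnes m) := by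
      ext; simp [mul_sub]; ring
    rw [hsub, Matrix.hadamard_smul, upperSum_sub, upperSum_smul,
      upperSum_hadamard_skewOnes]
  -- Pairing with `P` itself recovers half the total sum; this identifies the Lagrange multiplier.
  have hPQ : upperSum (P ⊙ Q) = totalSum U / 2 := by
    rw [totalSum_eq_two_mul_upperSum hU.1 hU.2, mul_div_cancel_left₀ _ two_ne_zero]
    exact upperSum_congr fun i j h => by
      rw [Matrix.hadamard_apply, hQdef, entrywiseQuotient, Matrix.of_apply,
        mul_div_cancel₀ _ (hne i j h)]
  constructor
  · rintro ⟨-, hcrit⟩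
    simp only [sum_log_derivative] at hcrit
    refine mul_eq_zero_of_forall_upperSum hskew hW fun A => ?_
    set B := A * P + P * Aᵀ with hB
    have hder := hasDerivAt_congruenceCurve A P
    have hsder := hasDerivAt_upperSum hder
    have hs0 : upperSum (congruenceCurve A P 0) = 1 := by rw [congruenceCurve_zero, hsum]
    have hsne : upperSum (congruenceCurve A P 0) ≠ 0 := by rw [hs0]; exact one_ne_zero
    -- Congruence preserves the rank near `t = 0` but not the sum of the entries. Rescaling returns
    -- to the affine hyperplane and corrects the velocity by `upperSum B • P`.
    set γ : ℂ → Matrix (Fin m) (Fin m) ℂ := fun t =>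
      (upperSum (congruenceCurve A P t))⁻¹ • congruenceCurve A P t with hγ
    have hγder : ∀ i j, HasDerivAt (fun t => γ t i j) ((B - upperSum B • P) i j) 0 := by
      intro i j
      refine (((hsder.inv hsne).mul (hder i j)).congr_deriv ?_).congr_of_eventuallyEq
        (Filter.Eventually.of_forall fun t => rfl)
      simp only [Pi.inv_apply, congruenceCurve_zero, hsum, Matrix.sub_apply, Matrix.smul_apply,
        smul_eq_mul]
      rw [← hB]
      ring
    have hγ0 : γ 0 = P := by simp [hγ, congruenceCurve_zero, hsum]
    have hmem : ∀ᶠ t in nhds (0 : ℂ), γ t ∈ AM m r := by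
      filter_upwards [rank_congruenceCurve A P, hsder.continuousAt.eventually_ne hsne,
        eventually_entries_ne_zero hγder (fun i j h => by rw [hγ0]; exact hne i j h)]
        with t h1 h2 h3
      refine ⟨?_, ?_, ?_, h3⟩
      · simp only [hγ, Matrix.transpose_smul, congruenceCurve_skew A hskew, smul_neg]
      · simp only [hγ, upperSum_smul, inv_mul_cancel₀ h2]
      · simp only [hγ]
        rw [Matrix.rank_smul_of_mem_nonZeroDivisors _
          (mem_nonZeroDivisors_of_ne_zero (inv_ne_zero h2)), h1, hrank]
    have h := hcrit _ (mem_tangentSpace_of_curve hγder hγ0 hmem)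
    have hsub : (B - upperSum B • P) ⊙ Q = B ⊙ Q - (upperSum B • P) ⊙ Q := by
      ext; simp [sub_mul]; ring
    rw [hsub, Matrix.smul_hadamard, upperSum_sub, upperSum_smul, hPQ] at h
    rw [hpair]
    linear_combination h
  · intro h
    refine ⟨hP, fun V hV => ?_⟩
    rw [sum_log_derivative]
    have hVs := skew_of_mem_tangentSpace (fun Y hY => hY.1) hV hP
    have hV0 := upperSum_of_mem_tangentSpace (fun Y hY => hY.2.1) hV
    have htr := trace_mul_eq_zero_of_mem_tangentSpace (A := 0) (M := P) one_ne_zero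
      (fun Y hY => by rw [zero_add, one_smul, hY.2.2.1, hrank]) (by rw [zero_add, one_smul]) hV h
      (mul_eq_zero_comm_of_skew hskew hW h)
    rw [trace_mul_of_skew hVs hW, hpair, hV0] at htr
    simpa using htr

/-- The likelihood equations on `AM' m s`. -/
theorem mem_criticalPoints_AM'_iff {s : ℕ} {U Y : Matrix (Fin m) (Fin m) ℂ}
    (hU : U ∈ dataMatrices m) (hY : Y ∈ AM' m s) :
    Y ∈ criticalPoints U (AM' m s) ↔ entrywiseQuotient U Y * (skewOnes m - Y) = 0 := by
  obtain ⟨hskew, hne, hrank⟩ := id hY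
  have hW := entrywiseQuotient_skew hU hskew
  set W := entrywiseQuotient U Y with hWdef
  have hM : (skewOnes m - Y)ᵀ = -(skewOnes m - Y) := by
    rw [Matrix.transpose_sub, hskew, skewOnes_skew]; abel
  set M := skewOnes m - Y with hMdef
  constructor
  · rintro ⟨-, hcrit⟩
    simp only [sum_log_derivative] at hcrit
    refine mul_eq_zero_comm_of_skew hM hW (mul_eq_zero_of_forall_upperSum hM hW fun A => ?_)
    have hder := hasDerivAt_congruenceCurve A M
    set B := A * M + M * Aᵀ with hB
    have hγder : ∀ i j, HasDerivAt (fun t => (skewOnes m - congruenceCurve A M t) i j)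
        ((-B) i j) 0 := fun i j => (hder i j).const_sub (skewOnes m i j)
    have hγ0 : skewOnes m - congruenceCurve A M 0 = Y := by
      rw [congruenceCurve_zero, hMdef]; abel
    have hmem : ∀ᶠ t in nhds (0 : ℂ), skewOnes m - congruenceCurve A M t ∈ AM' m s := by
      filter_upwards [rank_congruenceCurve A M,
        eventually_entries_ne_zero hγder (fun i j h => by rw [hγ0]; exact hne i j h)] with t h1 h2
      refine ⟨?_, h2, ?_⟩
      · rw [Matrix.transpose_sub, congruenceCurve_skew A hM, skewOnes_skew]; abel
      · rw [sub_sub_cancel, h1, hrank]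
    have h := hcrit _ (mem_tangentSpace_of_curve hγder hγ0 hmem)
    have hneg : (-B) ⊙ W = (-1 : ℂ) • (B ⊙ W) := by ext; simp
    rw [hneg, upperSum_smul] at h
    simpa using h
  · intro h
    refine ⟨hY, fun V hV => ?_⟩
    rw [sum_log_derivative]
    have hVs := skew_of_mem_tangentSpace (fun Y hY => hY.1) hV hY
    have htr := trace_mul_eq_zero_of_mem_tangentSpace (A := skewOnes m) (M := M) (c := -1)
      (by norm_num) (fun Z hZ => by rw [neg_one_smul, ← sub_eq_add_neg, hZ.2.2, hrank])
      (by rw [neg_one_smul, ← sub_eq_add_neg]) hV (mul_eq_zero_comm_of_skew hW hM h) h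
    rw [trace_mul_of_skew hVs hW] at htr
    simpa using htr

end Critical

/-! ### The variety of dual pairs -/

section DualPairs

variable {m : ℕ}

theorem skew_ext {A B : Matrix (Fin m) (Fin m) ℂ} (hA : Aᵀ = -A) (hB : Bᵀ = -B)
    (h : ∀ i j, i < j → A i j = B i j) : A = B := by
  ext i j
  rcases lt_trichotomy i j with hij | rfl | hij
  · exact h i j hij
  · rw [skew_apply_self hA, skew_apply_self hB]
  · rw [skew_apply hA, skew_apply hB, h j i hij]

/-- The pairs of skew matrices `P` and `R` of rank at most `a` and `b` with product zero such that
`U` is the entrywise product of `P` and `S - R`. -/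
def dualPairs (U : Matrix (Fin m) (Fin m) ℂ) (a b : ℕ) :
    Set (Matrix (Fin m) (Fin m) ℂ × Matrix (Fin m) (Fin m) ℂ) :=
  {x | x.1ᵀ = -x.1 ∧ x.2ᵀ = -x.2 ∧ x.1 * x.2 = 0 ∧ x.1.rank ≤ a ∧ x.2.rank ≤ b ∧
    ∀ i j, i < j → x.1 i j * (1 - x.2 i j) = U i j}

/-- The `c`-th matrix of a point of the space of pairs of matrices. -/
def pairMatrix {L : Type*} (z : Bool × Fin m × Fin m → L) (c : Bool) : Matrix (Fin m) (Fin m) L :=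
  Matrix.of fun i j => z (c, i, j)

/-- The equations for the pairs of skew matrices of rank at most `a` and `b` with product zero. -/
def pairSystem (m a b : ℕ) : Set (MvPolynomial (Bool × Fin m × Fin m) ℂ) :=
  {p | (∃ c i j, p = MvPolynomial.X (c, i, j) + MvPolynomial.X (c, j, i)) ∨
    (∃ i j : Fin m, p = (pairMatrix MvPolynomial.X false * pairMatrix MvPolynomial.X true :
      Matrix (Fin m) (Fin m) (MvPolynomial (Bool × Fin m × Fin m) ℂ)) i j) ∨
    (∃ I : Finset (Fin m), a < I.card ∧
      p = ((pairMatrix MvPolynomial.X false).submatrix ((↑) : I → Fin m) ((↑) : I → Fin m)).det) ∨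
    ∃ I : Finset (Fin m), b < I.card ∧
      p = ((pairMatrix MvPolynomial.X true).submatrix ((↑) : I → Fin m) ((↑) : I → Fin m)).det}

/-- The entries above the diagonal of the entrywise product of `P` and `S - R`. -/
noncomputable def pairProduct (m : ℕ) (p : {p : Fin m × Fin m // p.1 < p.2}) :
    MvPolynomial (Bool × Fin m × Fin m) ℂ :=
  MvPolynomial.X (false, p.1) * (1 - MvPolynomial.X (true, p.1))

/-- Principal minors suffice to bound ranks of skew matrices. The equivalence is needed over
extension fields so that generic points of components are again pairs of skew matrices. -/
theorem pairSystem_iff {L : Type*} [Field L] [Algebra ℂ L] (a b : ℕ)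
    (z : Bool × Fin m × Fin m → L) :
    (∀ p ∈ pairSystem m a b, MvPolynomial.aeval z p = 0) ↔
      (pairMatrix z false)ᵀ = -pairMatrix z false ∧ (pairMatrix z true)ᵀ = -pairMatrix z true ∧
      pairMatrix z false * pairMatrix z true = 0 ∧ (pairMatrix z false).rank ≤ a ∧
      (pairMatrix z true).rank ≤ b := by
  have hdet : ∀ (c : Bool) (I : Finset (Fin m)), MvPolynomial.aeval z
      ((pairMatrix (MvPolynomial.X (R := ℂ)) c).submatrix
        ((↑) : I → Fin m) ((↑) : I → Fin m)).det =
      ((pairMatrix z c).submatrix ((↑) : I → Fin m) ((↑) : I → Fin m)).det := by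
    intro c I
    rw [AlgHom.map_det]
    congr 1
    ext i j
    simp [pairMatrix]
  have hmul : ∀ i j, MvPolynomial.aeval z ((pairMatrix (MvPolynomial.X (R := ℂ)) false *
      pairMatrix MvPolynomial.X true : Matrix (Fin m) (Fin m) _) i j) =
      (pairMatrix z false * pairMatrix z true) i j := by
    intro i j
    simp [Matrix.mul_apply, pairMatrix]
  have hskew : ∀ c, (∀ i j, z (c, i, j) + z (c, j, i) = 0) ↔
      (pairMatrix z c)ᵀ = -pairMatrix z c := by
    intro c
    constructor
    · intro h; ext i j
      exact eq_neg_of_add_eq_zero_left (h j i)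
    · intro h i j
      have := skew_apply h i j
      exact eq_neg_iff_add_eq_zero.1 this
  constructor
  · intro h
    have hs : ∀ c, (pairMatrix z c)ᵀ = -pairMatrix z c := fun c => (hskew c).1 fun i j => by
      simpa using h _ (Or.inl ⟨c, i, j, rfl⟩)
    refine ⟨hs _, hs _, ?_, (rank_le_iff_principal_minors (hs _) a).2 fun I hI => ?_,
      (rank_le_iff_principal_minors (hs _) b).2 fun I hI => ?_⟩
    · ext i j
      rw [← hmul]
      exact h _ (Or.inr (Or.inl ⟨i, j, rfl⟩))
    · rw [← hdet]
      exact h _ (Or.inr (Or.inr (Or.inl ⟨I, hI, rfl⟩)))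
    · rw [← hdet]
      exact h _ (Or.inr (Or.inr (Or.inr ⟨I, hI, rfl⟩)))
  · rintro ⟨h1, h2, h3, h4, h5⟩ p (⟨c, i, j, rfl⟩ | ⟨i, j, rfl⟩ | ⟨I, hI, rfl⟩ | ⟨I, hI, rfl⟩)
    · have hs : (pairMatrix z c)ᵀ = -pairMatrix z c := by cases c; exacts [h1, h2]
      simpa using (hskew c).2 hs i j
    · rw [hmul, h3]; rfl
    · rw [hdet]; exact (rank_le_iff_principal_minors h1 a).1 h4 I hI
    · rw [hdet]; exact (rank_le_iff_principal_minors h2 b).1 h5 I hI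

theorem aeval_pairProduct {L : Type*} [Field L] [Algebra ℂ L] (z : Bool × Fin m × Fin m → L)
    (p : {p : Fin m × Fin m // p.1 < p.2}) :
    MvPolynomial.aeval z (pairProduct m p) =
      pairMatrix z false p.1.1 p.1.2 * (1 - pairMatrix z true p.1.1 p.1.2) := by
  simp [pairProduct, pairMatrix]

/-- The entries of a matrix above the diagonal. -/
def upperEntries {L : Type*} (U : Matrix (Fin m) (Fin m) L) (p : {p : Fin m × Fin m // p.1 < p.2}) :
    L :=
  U p.1.1 p.1.2

theorem dualPairs_eq_image (U : Matrix (Fin m) (Fin m) ℂ) (a b : ℕ) :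
    dualPairs U a b = (fun z => (pairMatrix z false, pairMatrix z true)) ''
      systemFiber (pairSystem m a b) (pairProduct m) (upperEntries U) := by
  have hmem : ∀ z : Bool × Fin m × Fin m → ℂ,
      z ∈ systemFiber (pairSystem m a b) (pairProduct m) (upperEntries U) ↔
        (pairMatrix z false, pairMatrix z true) ∈ dualPairs U a b := by
    intro z
    have h1 := pairSystem_iff a b z
    have h2 := aeval_pairProduct z
    simp only [MvPolynomial.aeval_eq_eval] at h1 h2
    rw [systemFiber, Set.mem_ofPred_eq, dualPairs, Set.mem_ofPred_eq]
    refine (and_congr h1 ?_).trans ⟨fun ⟨⟨h1, h2, h3, h4, h5⟩, h6⟩ => ⟨h1, h2, h3, h4, h5, h6⟩,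
      fun ⟨h1, h2, h3, h4, h5, h6⟩ => ⟨⟨h1, h2, h3, h4, h5⟩, h6⟩⟩
    refine ⟨fun h i j hij => (h2 ⟨(i, j), hij⟩).symm.trans (h ⟨(i, j), hij⟩),
      fun h p => (h2 p).trans (h _ _ p.2)⟩
  ext ⟨P, R⟩
  constructor
  · intro h
    refine ⟨fun t => if t.1 then R t.2.1 t.2.2 else P t.2.1 t.2.2, ?_, ?_⟩
    · rw [hmem]
      exact h
    · rfl
  · rintro ⟨z, hz, h⟩
    rw [← h]
    exact (hmem z).1 hz

theorem encard_dualPairs (U : Matrix (Fin m) (Fin m) ℂ) (a b : ℕ) :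
    (dualPairs U a b).encard =
      (systemFiber (pairSystem m a b) (pairProduct m) (upperEntries U)).encard := by
  rw [dualPairs_eq_image]
  refine Function.Injective.encard_image (fun z z' h => ?_) _
  ext ⟨c, i, j⟩
  cases c
  · exact congrFun (congrFun (congrArg Prod.fst h) i) j
  · exact congrFun (congrFun (congrArg Prod.snd h) i) j

/-- At a point with algebraically independent image the ranks add up to at least `m - 1`. Both are
even, so lowering one of the even bounds `r`, `s` costs at least two and leaves at most `m - 2`. -/
theorem exists_dualPairs_eq_empty {r s a b : ℕ} (hr : Even r) (hs : Even s) (hrs : r + s ≤ m)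
    (hab : a < r ∧ b ≤ s ∨ a ≤ r ∧ b < s) :
    ∃ f : MvPolynomial {p : Fin m × Fin m // p.1 < p.2} ℂ, f ≠ 0 ∧
      ∀ U : Matrix (Fin m) (Fin m) ℂ, MvPolynomial.eval (upperEntries U) f ≠ 0 →
        dualPairs U a b = ∅ := by
  obtain ⟨f, hf, h⟩ := exists_systemFiber_eq_empty (pairSystem m a b) (pairProduct m) (by
    intro L _ _ z hz hind
    have hL : CharZero L := charZero_of_injective_algebraMap (algebraMap ℂ L).injective
    obtain ⟨h1, h2, h3, h4, h5⟩ := (pairSystem_iff a b z).1 hz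
    have h6 := (rank_add_rank_of_algebraicIndependent h1 h2 h3 (aeval_pairProduct z) hind).1
    have h7 := even_rank_of_skew h1
    have h8 := even_rank_of_skew h2
    grind)
  refine ⟨f, hf, fun U hU => ?_⟩
  rw [dualPairs_eq_image, h _ hU, Set.image_empty]

theorem exists_dualPairs_encard (m r s : ℕ) :
    ∃ f : MvPolynomial {p : Fin m × Fin m // p.1 < p.2} ℂ, f ≠ 0 ∧ ∃ d : ℕ,
      ∀ U : Matrix (Fin m) (Fin m) ℂ, MvPolynomial.eval (upperEntries U) f ≠ 0 →
        (dualPairs U r s).encard = d := by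
  obtain ⟨f, hf, d, h⟩ := exists_systemFiber_encard (pairSystem m r s) (pairProduct m) (by
    rintro L _ _ z hz hind ⟨c, i, j⟩
    have hL : CharZero L := charZero_of_injective_algebraMap (algebraMap ℂ L).injective
    obtain ⟨h1, h2, h3, -, -⟩ := (pairSystem_iff r s z).1 hz
    have h := (rank_add_rank_of_algebraicIndependent h1 h2 h3 (aeval_pairProduct z) hind).2 i j
    cases c
    exacts [h.1, h.2])
  refine ⟨f, hf, d, fun U hU => ?_⟩
  rw [encard_dualPairs, h _ hU]

/-- For general data, the dual pairs have maximal rank and their number is constant. -/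
theorem exists_dualPairs_generic {r s : ℕ} (hr : Even r) (hs : Even s) (hrs : r + s ≤ m) :
    ∃ f : MvPolynomial {p : Fin m × Fin m // p.1 < p.2} ℂ, f ≠ 0 ∧ ∃ d : ℕ,
      ∀ U : Matrix (Fin m) (Fin m) ℂ, MvPolynomial.eval (upperEntries U) f ≠ 0 →
        (dualPairs U r s).encard = d ∧
          ∀ x ∈ dualPairs U r s, x.1.rank = r ∧ x.2.rank = s := by
  obtain ⟨f, hf, d, hd⟩ := exists_dualPairs_encard m r s
  have h1 : ∃ f : MvPolynomial {p : Fin m × Fin m // p.1 < p.2} ℂ, f ≠ 0 ∧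
      ∀ U : Matrix (Fin m) (Fin m) ℂ, MvPolynomial.eval (upperEntries U) f ≠ 0 →
        ∀ x ∈ dualPairs U r s, x.1.rank = r := by
    rcases Nat.eq_zero_or_pos r with rfl | hpos
    · exact ⟨1, one_ne_zero, fun U _ x hx => Nat.le_zero.1 hx.2.2.2.1⟩
    · obtain ⟨f, hf, h⟩ := exists_dualPairs_eq_empty (a := r - 1) (b := s) hr hs hrs
        (Or.inl ⟨by omega, le_rfl⟩)
      refine ⟨f, hf, fun U hU x hx => ?_⟩
      by_contra hne
      obtain ⟨e1, e2, e3, e4, e5, e6⟩ := hx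
      have : x ∈ dualPairs U (r - 1) s := ⟨e1, e2, e3, by omega, e5, e6⟩
      rwa [h U hU] at this
  have h2 : ∃ f : MvPolynomial {p : Fin m × Fin m // p.1 < p.2} ℂ, f ≠ 0 ∧
      ∀ U : Matrix (Fin m) (Fin m) ℂ, MvPolynomial.eval (upperEntries U) f ≠ 0 →
        ∀ x ∈ dualPairs U r s, x.2.rank = s := by
    rcases Nat.eq_zero_or_pos s with rfl | hpos
    · exact ⟨1, one_ne_zero, fun U _ x hx => Nat.le_zero.1 hx.2.2.2.2.1⟩
    · obtain ⟨f, hf, h⟩ := exists_dualPairs_eq_empty (a := r) (b := s - 1) hr hs hrs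
        (Or.inr ⟨le_rfl, by omega⟩)
      refine ⟨f, hf, fun U hU x hx => ?_⟩
      by_contra hne
      obtain ⟨e1, e2, e3, e4, e5, e6⟩ := hx
      have : x ∈ dualPairs U r (s - 1) := ⟨e1, e2, e3, e4, by omega, e6⟩
      rwa [h U hU] at this
  obtain ⟨g, hg, hg'⟩ := h1
  obtain ⟨h, hh, hh'⟩ := h2
  refine ⟨f * g * h, mul_ne_zero (mul_ne_zero hf hg) hh, d, fun U hU => ?_⟩
  rw [map_mul, map_mul] at hU
  have hfg := left_ne_zero_of_mul hU
  exact ⟨hd U (left_ne_zero_of_mul hfg), fun x hx =>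
    ⟨hg' U (right_ne_zero_of_mul hfg) x hx, hh' U (right_ne_zero_of_mul hU) x hx⟩⟩

theorem forGeneralData_of_upperEntries {p : Matrix (Fin m) (Fin m) ℂ → Prop}
    {f : MvPolynomial {p : Fin m × Fin m // p.1 < p.2} ℂ} (hf : f ≠ 0)
    (h : ∀ U ∈ dataMatrices m, MvPolynomial.eval (upperEntries U) f ≠ 0 → p U) :
    ForGeneralData m p := by
  have hev : ∀ U : Matrix (Fin m) (Fin m) ℂ,
      evalMatrix U (MvPolynomial.rename Subtype.val f) = MvPolynomial.eval (upperEntries U) f := by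
    intro U
    rw [evalMatrix, MvPolynomial.eval_rename]
    rfl
  refine ⟨MvPolynomial.rename Subtype.val f, ?_, fun U hU hne => h U hU (by rwa [← hev])⟩
  obtain ⟨u, hu⟩ : ∃ u, MvPolynomial.eval u f ≠ 0 := by
    by_contra! hcon
    exact hf (MvPolynomial.funext fun u => by rw [hcon u, map_zero])
  -- A point off the hypersurface, extended symmetrically with zero diagonal, shows that the open
  -- set meets the data matrices.
  refine ⟨Matrix.of fun i j => if h : i < j then u ⟨(i, j), h⟩ else
    if h : j < i then u ⟨(j, i), h⟩ else 0, ⟨?_, fun i => by simp⟩, ?_⟩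
  · ext i j
    rw [Matrix.transpose_apply, Matrix.of_apply, Matrix.of_apply]
    rcases lt_trichotomy i j with h | rfl | h
    · simp [h, h.not_gt]
    · simp
    · simp [h, h.not_gt]
  · rw [hev]
    convert hu using 3
    ext ⟨⟨i, j⟩, hij⟩
    simp only [upperEntries, Matrix.of_apply]
    rw [dif_pos hij]

theorem exists_nondegenerate_data (hm : 2 ≤ m) :
    ∃ f : MvPolynomial {p : Fin m × Fin m // p.1 < p.2} ℂ, f ≠ 0 ∧
      ∀ U ∈ dataMatrices m, MvPolynomial.eval (upperEntries U) f ≠ 0 →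
        totalSum U ≠ 0 ∧ ∀ i j, i < j → U i j ≠ 0 := by
  set g : MvPolynomial {p : Fin m × Fin m // p.1 < p.2} ℂ :=
    ∑ i, ∑ j, if h : i < j then MvPolynomial.X ⟨(i, j), h⟩ else 0 with hg
  have hev : ∀ U : Matrix (Fin m) (Fin m) ℂ,
      MvPolynomial.eval (upperEntries U) g = upperSum U := by
    intro U
    rw [upperSum_eq_sum_ite, hg, map_sum]
    refine Finset.sum_congr rfl fun i _ => ?_
    rw [map_sum]
    refine Finset.sum_congr rfl fun j _ => ?_
    by_cases h : i < j <;> simp [h, upperEntries]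
  have hg0 : g ≠ 0 := by
    intro h0
    have := hev (Matrix.single ⟨0, by omega⟩ ⟨1, by omega⟩ 1)
    rw [h0, map_zero, upperSum_eq_sum_ite, Finset.sum_eq_single ⟨0, by omega⟩,
      Finset.sum_eq_single ⟨1, by omega⟩] at this
    · simp at this
    · intro j _ hj
      simp [hj.symm]
    · simp
    · intro i _ hi
      refine Finset.sum_eq_zero fun j _ => ?_
      simp [hi.symm]
    · simp
  refine ⟨g * ∏ p, MvPolynomial.X p, mul_ne_zero hg0
    (Finset.prod_ne_zero_iff.2 fun p _ => MvPolynomial.X_ne_zero p), fun U hU hne => ?_⟩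
  rw [map_mul, hev, map_prod] at hne
  refine ⟨?_, fun i j hij => ?_⟩
  · rw [totalSum_eq_two_mul_upperSum hU.1 hU.2]
    exact mul_ne_zero two_ne_zero (left_ne_zero_of_mul hne)
  · have := Finset.prod_ne_zero_iff.1 (right_ne_zero_of_mul hne) ⟨(i, j), hij⟩ (Finset.mem_univ _)
    simpa [upperEntries] using this

end DualPairs

/-! ### Duality -/

section Duality

variable {m : ℕ}

theorem skewOnes_apply_of_lt {i j : Fin m} (h : i < j) : skewOnes m i j = 1 := by
  simp [skewOnes, h]

theorem dualPoint_skew {U P : Matrix (Fin m) (Fin m) ℂ} (hU : U ∈ dataMatrices m)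
    (hP : Pᵀ = -P) : (dualPoint U P)ᵀ = -dualPoint U P := by
  rw [dualPoint, Matrix.transpose_smul, entrywiseQuotient_skew hU hP, smul_neg]

theorem dualPoint_apply (U P : Matrix (Fin m) (Fin m) ℂ) (i j : Fin m) :
    dualPoint U P i j = 2 / totalSum U * (U i j / P i j) := rfl

theorem dualPoint_dualPoint {U P : Matrix (Fin m) (Fin m) ℂ} (hU : U ∈ dataMatrices m)
    (hU0 : totalSum U ≠ 0) (hne : ∀ i j, i < j → U i j ≠ 0) (hP : Pᵀ = -P)
    (hPne : ∀ i j, i < j → P i j ≠ 0) : dualPoint U (dualPoint U P) = P := by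
  refine skew_ext (dualPoint_skew hU (dualPoint_skew hU hP)) hP fun i j h => ?_
  have h1 := hne i j h
  have h2 := hPne i j h
  rw [dualPoint_apply, dualPoint_apply]
  field_simp

/-- With `R = S - Q'` the likelihood equation becomes `P * R = 0`, and the scale `U₊₊ / 2` on `P`
cancels the one in `Q'`. The rank of `R` is even and at most `m - r`, hence at most `s` by the
maximality of `s`. -/
theorem mem_dualPairs_of_mem_criticalPoints_AM {r s : ℕ} {U P : Matrix (Fin m) (Fin m) ℂ}
    (hs : IsGreatest {k : ℕ | Even k ∧ k ≤ m - r} s) (hU : U ∈ dataMatrices m)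
    (hU0 : totalSum U ≠ 0) (hP : P ∈ criticalPoints U (AM m r)) :
    ((totalSum U / 2) • P, skewOnes m - dualPoint U P) ∈ dualPairs U r s := by
  have hcrit := (mem_criticalPoints_AM_iff hU hP.1).1 hP
  obtain ⟨hskew, hsum, hrank, hne⟩ := hP.1
  have hskew1 : ((totalSum U / 2) • P)ᵀ = -((totalSum U / 2) • P) := by
    rw [Matrix.transpose_smul, hskew, smul_neg]
  have hskew2 : (skewOnes m - dualPoint U P)ᵀ = -(skewOnes m - dualPoint U P) := by
    rw [Matrix.transpose_sub, dualPoint_skew hU hskew, skewOnes_skew]; abel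
  have hdual : skewOnes m - dualPoint U P =
      (-(2 / totalSum U)) • (entrywiseQuotient U P - (totalSum U / 2) • skewOnes m) := by
    have h1 : -(2 / totalSum U) * -(totalSum U / 2) = 1 := by field_simp
    rw [smul_sub, smul_smul, sub_eq_add_neg _ (_ • skewOnes m), ← neg_smul, ← mul_neg, h1,
      one_smul, neg_smul, ← dualPoint]
    abel
  have hmul : P * (skewOnes m - dualPoint U P) = 0 := by
    rw [hdual, Matrix.mul_smul, hcrit, smul_zero]
  have hrank1 : ((totalSum U / 2) • P).rank = r := by
    rw [Matrix.rank_smul_of_mem_nonZeroDivisors _ (mem_nonZeroDivisors_of_ne_zero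
      (div_ne_zero hU0 two_ne_zero)), hrank]
  refine ⟨hskew1, hskew2, ?_, hrank1.le, ?_, fun i j h => ?_⟩
  · rw [Matrix.smul_mul, hmul, smul_zero]
  · have h1 := Matrix.rank_add_rank_le_card_of_mul_eq_zero hmul
    rw [hrank, Fintype.card_fin] at h1
    have h2 : (skewOnes m - dualPoint U P).rank ≤ m - r := by omega
    exact hs.2 ⟨even_rank_of_skew hskew2, h2⟩
  · have h1 := hne i j h
    simp only [Matrix.smul_apply, Matrix.sub_apply, smul_eq_mul, skewOnes_apply_of_lt h,
      dualPoint_apply]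
    field_simp
    ring

theorem mem_dualPairs_of_mem_criticalPoints_AM' {r s : ℕ} {U Y : Matrix (Fin m) (Fin m) ℂ}
    (hr : Even r) (hs : IsGreatest {k : ℕ | Even k ∧ k ≤ m - r} s) (hU : U ∈ dataMatrices m)
    (hY : Y ∈ criticalPoints U (AM' m s)) :
    (entrywiseQuotient U Y, skewOnes m - Y) ∈ dualPairs U r s := by
  have hcrit := (mem_criticalPoints_AM'_iff hU hY.1).1 hY
  obtain ⟨hskew, hne, hrank⟩ := hY.1
  have hQ := entrywiseQuotient_skew hU hskew
  have hM : (skewOnes m - Y)ᵀ = -(skewOnes m - Y) := by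
    rw [Matrix.transpose_sub, hskew, skewOnes_skew]; abel
  refine ⟨hQ, hM, hcrit, ?_, hrank.le, fun i j h => ?_⟩
  · have h1 := Matrix.rank_add_rank_le_card_of_mul_eq_zero hcrit
    rw [hrank, Fintype.card_fin] at h1
    -- Maximality of `s` turns the bound `m - s` on the rank of the quotient into less than `r + 2`;
    -- evenness improves this to `r`.
    have h2 : m - r < s + 2 := by
      by_contra hcon
      have := hs.2 (show s + 2 ∈ {k : ℕ | Even k ∧ k ≤ m - r} from
        ⟨hs.1.1.add even_two, by omega⟩)
      omega
    have h3 := even_rank_of_skew hQ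
    grind
  · simp only [Matrix.sub_apply, skewOnes_apply_of_lt h, sub_sub_cancel, entrywiseQuotient,
      Matrix.of_apply]
    exact div_mul_cancel₀ _ (hne i j h)

theorem entries_ne_zero_of_mem_dualPairs {a b : ℕ} {U P R : Matrix (Fin m) (Fin m) ℂ}
    (hne : ∀ i j, i < j → U i j ≠ 0) (hx : (P, R) ∈ dualPairs U a b) {i j : Fin m} (h : i < j) :
    P i j ≠ 0 ∧ (skewOnes m - R) i j ≠ 0 := by
  have h1 := hne i j h
  rw [← hx.2.2.2.2.2 i j h] at h1
  refine ⟨left_ne_zero_of_mul h1, ?_⟩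
  rw [Matrix.sub_apply, skewOnes_apply_of_lt h]
  exact right_ne_zero_of_mul h1

theorem entrywiseQuotient_of_mem_dualPairs {a b : ℕ} {U P R : Matrix (Fin m) (Fin m) ℂ}
    (hU : U ∈ dataMatrices m) (hne : ∀ i j, i < j → U i j ≠ 0)
    (hx : (P, R) ∈ dualPairs U a b) :
    entrywiseQuotient U P = skewOnes m - R ∧ entrywiseQuotient U (skewOnes m - R) = P := by
  obtain ⟨h1, h2, -, -, -, h6⟩ := id hx
  simp only at h1 h2 h6
  have h3 : (skewOnes m - R)ᵀ = -(skewOnes m - R) := by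
    rw [Matrix.transpose_sub, h2, skewOnes_skew]; abel
  refine ⟨skew_ext (entrywiseQuotient_skew hU h1) h3 fun i j h => ?_,
    skew_ext (entrywiseQuotient_skew hU h3) h1 fun i j h => ?_⟩
  · rw [entrywiseQuotient, Matrix.of_apply, ← h6 i j h, Matrix.sub_apply, skewOnes_apply_of_lt h,
      mul_div_cancel_left₀ _ (entries_ne_zero_of_mem_dualPairs hne hx h).1]
  · have h4 := (entries_ne_zero_of_mem_dualPairs hne hx h).2
    rw [Matrix.sub_apply, skewOnes_apply_of_lt h] at h4
    rw [entrywiseQuotient, Matrix.of_apply, ← h6 i j h, Matrix.sub_apply, skewOnes_apply_of_lt h,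
      mul_div_cancel_right₀ _ h4]

theorem entrywiseQuotient_smul (U P : Matrix (Fin m) (Fin m) ℂ) (c : ℂ) :
    entrywiseQuotient U (c • P) = c⁻¹ • entrywiseQuotient U P := by
  ext i j
  simp only [entrywiseQuotient, Matrix.of_apply, Matrix.smul_apply, smul_eq_mul, div_eq_mul_inv,
    mul_inv]
  ring

theorem smul_mem_criticalPoints_AM {r s : ℕ} {U P R : Matrix (Fin m) (Fin m) ℂ}
    (hU : U ∈ dataMatrices m) (hU0 : totalSum U ≠ 0) (hne : ∀ i j, i < j → U i j ≠ 0)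
    (hx : (P, R) ∈ dualPairs U r s) (hrank : P.rank = r) :
    (2 / totalSum U) • P ∈ criticalPoints U (AM m r) := by
  obtain ⟨h1, h2, h3, -, -, h6⟩ := id hx
  simp only at h1 h2 h3 h6
  have hc : 2 / totalSum U ≠ 0 := div_ne_zero two_ne_zero hU0
  -- The normalization is automatic: the trace of `P * R = 0`, together with the entrywise equation,
  -- equates the upper sums of `P` and `U`.
  have hsum : upperSum P = totalSum U / 2 := by
    have htr := congrArg Matrix.trace h3
    rw [trace_mul_of_skew h1 h2, Matrix.trace_zero] at htr
    have hR : upperSum (P ⊙ R) = upperSum P - upperSum U := by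
      rw [← upperSum_sub]
      refine upperSum_congr fun i j h => ?_
      rw [Matrix.hadamard_apply, Matrix.sub_apply, ← h6 i j h]
      ring
    rw [hR] at htr
    rw [totalSum_eq_two_mul_upperSum hU.1 hU.2]
    linear_combination (-1 / 2 : ℂ) * htr
  have hAM : (2 / totalSum U) • P ∈ AM m r := by
    refine ⟨?_, ?_, ?_, fun i j h => ?_⟩
    · rw [Matrix.transpose_smul, h1, smul_neg]
    · rw [upperSum_smul, hsum]
      field_simp
    · rw [Matrix.rank_smul_of_mem_nonZeroDivisors _ (mem_nonZeroDivisors_of_ne_zero hc), hrank]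
    · exact mul_ne_zero hc (entries_ne_zero_of_mem_dualPairs hne hx h).1
  rw [mem_criticalPoints_AM_iff hU hAM, entrywiseQuotient_smul,
    (entrywiseQuotient_of_mem_dualPairs hU hne hx).1, inv_div, ← smul_sub, sub_sub_cancel_left,
    Matrix.smul_mul, Matrix.mul_smul, Matrix.mul_neg, h3, neg_zero, smul_zero, smul_zero]

theorem sub_mem_criticalPoints_AM' {r s : ℕ} {U P R : Matrix (Fin m) (Fin m) ℂ}
    (hU : U ∈ dataMatrices m) (hne : ∀ i j, i < j → U i j ≠ 0)
    (hx : (P, R) ∈ dualPairs U r s) (hrank : R.rank = s) :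
    skewOnes m - R ∈ criticalPoints U (AM' m s) := by
  obtain ⟨-, h2, h3, -, -, -⟩ := id hx
  simp only at h2 h3
  have hAM : skewOnes m - R ∈ AM' m s := by
    refine ⟨?_, fun i j h => (entries_ne_zero_of_mem_dualPairs hne hx h).2, ?_⟩
    · rw [Matrix.transpose_sub, h2, skewOnes_skew]; abel
    · rw [sub_sub_cancel, hrank]
  rw [mem_criticalPoints_AM'_iff hU hAM, (entrywiseQuotient_of_mem_dualPairs hU hne hx).2,
    sub_sub_cancel, h3]

theorem hadamard_eq_iff_eq_entrywiseQuotient {U P : Matrix (Fin m) (Fin m) ℂ}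
    (hU : U ∈ dataMatrices m) (hP : Pᵀ = -P) (hne : ∀ i j, i < j → P i j ≠ 0)
    (Q : Matrix (Fin m) (Fin m) ℂ) :
    (Qᵀ = -Q ∧ P ⊙ Q = U) ↔ Q = entrywiseQuotient U P := by
  constructor
  · rintro ⟨hQ, hPQ⟩
    refine skew_ext hQ (entrywiseQuotient_skew hU hP) fun i j h => ?_
    rw [entrywiseQuotient, Matrix.of_apply, ← hPQ, Matrix.hadamard_apply,
      mul_div_cancel_left₀ _ (hne i j h)]
  · rintro rfl
    refine ⟨entrywiseQuotient_skew hU hP, ?_⟩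
    have hoff : ∀ i j, i ≠ j → P i j ≠ 0 := by
      intro i j hij
      rcases lt_or_gt_of_ne hij with h | h
      · exact hne i j h
      · rw [skew_apply hP]; exact neg_ne_zero.2 (hne j i h)
    ext i j
    rw [Matrix.hadamard_apply, entrywiseQuotient, Matrix.of_apply]
    by_cases hij : i = j
    · subst hij
      rw [skew_apply_self hP, hU.2, zero_mul]
    · exact mul_div_cancel₀ _ (hoff i j hij)

theorem likelihood_mul {u : Matrix (Fin m) (Fin m) ℕ} {P Q T : Matrix (Fin m) (Fin m) ℂ}
    (h : ∀ i j, i < j → P i j * Q i j = T i j) :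
    likelihood u P * likelihood u Q = likelihood u T := by
  simp only [likelihood, ← Finset.prod_mul_distrib]
  refine Finset.prod_congr rfl fun i _ => Finset.prod_congr rfl fun j hj => ?_
  rw [← mul_pow, h i j (Finset.mem_Ioi.1 hj)]

/-- Logarithms of the factors add to logarithms of the product. Conversely, any logarithm of the
product splits after choosing principal logarithms for `P`. -/
theorem likelihoodValues_mul {U P Q T : Matrix (Fin m) (Fin m) ℂ}
    (hP : ∀ i j, i < j → P i j ≠ 0) (h : ∀ i j, i < j → P i j * Q i j = T i j) :
    likelihoodValues U P * likelihoodValues U Q = likelihoodValues U T := by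
  ext z
  rw [Set.mem_mul]
  constructor
  · rintro ⟨x, ⟨L, hL, rfl⟩, y, ⟨L', hL', rfl⟩, rfl⟩
    refine ⟨L + L', fun i j hij => ?_, ?_⟩
    · rw [Matrix.add_apply, Complex.exp_add, hL i j hij, hL' i j hij, h i j hij]
    · simp only [← Finset.prod_mul_distrib, ← Complex.exp_add, Matrix.add_apply, mul_add]
  · rintro ⟨L, hL, rfl⟩
    set K : Matrix (Fin m) (Fin m) ℂ := Matrix.of fun i j => Complex.log (P i j) with hK
    have hKe : ∀ i j, i < j → Complex.exp (K i j) = P i j := fun i j hij =>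
      Complex.exp_log (hP i j hij)
    refine ⟨_, ⟨K, hKe, rfl⟩, _, ⟨L - K, fun i j hij => ?_, rfl⟩, ?_⟩
    · rw [Matrix.sub_apply, Complex.exp_sub, hL i j hij, hKe i j hij, ← h i j hij,
        mul_div_cancel_left₀ _ (hP i j hij)]
    · simp only [← Finset.prod_mul_distrib, ← Complex.exp_add, Matrix.sub_apply, ← mul_add,
        add_sub_cancel]

end Duality

end MLDuality

open MLDuality

theorem mainTheorem3 (m r s : ℕ) (hr : Even r) (hr2 : 2 ≤ r) (hrm : r ≤ m)
    (hs : IsGreatest {k : ℕ | Even k ∧ k ≤ m - r} s) :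
    MLDuality.ForGeneralData m (fun U =>
      -- the skew matrix `Q` with `P * Q = U` exists, is unique, and is the entrywise quotient
      (∀ P ∈ MLDuality.criticalPoints U (MLDuality.AM m r),
        ∀ Q : Matrix (Fin m) (Fin m) ℂ,
          (Qᵀ = -Q ∧ P ⊙ Q = U) ↔ Q = MLDuality.entrywiseQuotient U P) ∧
      MLDuality.totalSum U ≠ 0 ∧
      -- `P ↦ Q' = 2 Q / U₊₊` is a bijection between the two critical sets
      Set.BijOn (MLDuality.dualPoint U)
        (MLDuality.criticalPoints U (MLDuality.AM m r))
        (MLDuality.criticalPoints U (MLDuality.AM' m s)) ∧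
      -- its inverse is given by the same formula
      Set.InvOn (MLDuality.dualPoint U) (MLDuality.dualPoint U)
        (MLDuality.criticalPoints U (MLDuality.AM m r))
        (MLDuality.criticalPoints U (MLDuality.AM' m s)) ∧
      -- the product of likelihoods is constant, for integral and for complex data
      (∀ u : Matrix (Fin m) (Fin m) ℕ, U = u.map (fun k : ℕ => (k : ℂ)) →
        ∃ c : ℂ, ∀ P ∈ MLDuality.criticalPoints U (MLDuality.AM m r),
          MLDuality.likelihood u P * MLDuality.likelihood u (MLDuality.dualPoint U P) = c) ∧
      (∃ C : Set ℂ, ∀ P ∈ MLDuality.criticalPoints U (MLDuality.AM m r),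
        MLDuality.likelihoodValues U P *
          MLDuality.likelihoodValues U (MLDuality.dualPoint U P) = C)) ∧
    -- the ML-degrees agree
    (∃ d : ℕ, MLDuality.IsMLDegree (MLDuality.AM m r) d ∧
      MLDuality.IsMLDegree (MLDuality.AM' m s) d) := by
  have hrs : r + s ≤ m := by
    have : s ≤ m - r := hs.1.2
    omega
  obtain ⟨f, hf, d, hgen⟩ := exists_dualPairs_generic hr hs.1.1 hrs
  obtain ⟨g, hg, hdata⟩ := exists_nondegenerate_data (hr2.trans hrm)
  have hfg : f * g ≠ 0 := mul_ne_zero hf hg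
  have hsplit : ∀ U : Matrix (Fin m) (Fin m) ℂ, MvPolynomial.eval (upperEntries U) (f * g) ≠ 0 →
      MvPolynomial.eval (upperEntries U) f ≠ 0 ∧ MvPolynomial.eval (upperEntries U) g ≠ 0 := by
    intro U hU
    rw [map_mul] at hU
    exact ⟨left_ne_zero_of_mul hU, right_ne_zero_of_mul hU⟩
  have hinv : ∀ U ∈ dataMatrices m, MvPolynomial.eval (upperEntries U) (f * g) ≠ 0 →
      Set.InvOn (dualPoint U) (dualPoint U) (criticalPoints U (AM m r))
        (criticalPoints U (AM' m s)) := by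
    intro U hU hne
    obtain ⟨hU0, hUne⟩ := hdata U hU (hsplit U hne).2
    exact ⟨fun P hP => dualPoint_dualPoint hU hU0 hUne hP.1.1 hP.1.2.2.2,
      fun Y hY => dualPoint_dualPoint hU hU0 hUne hY.1.1 hY.1.2.1⟩
  have hbij : ∀ U ∈ dataMatrices m, MvPolynomial.eval (upperEntries U) (f * g) ≠ 0 →
      Set.BijOn (dualPoint U) (criticalPoints U (AM m r)) (criticalPoints U (AM' m s)) := by
    intro U hU hne
    obtain ⟨hU0, hUne⟩ := hdata U hU (hsplit U hne).2
    have hranks := (hgen U (hsplit U hne).1).2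
    refine (hinv U hU hne).bijOn (fun P hP => ?_) fun Y hY => ?_
    · have hx := mem_dualPairs_of_mem_criticalPoints_AM hs hU hU0 hP
      have h := sub_mem_criticalPoints_AM' hU hUne hx (hranks _ hx).2
      rwa [sub_sub_cancel] at h
    -- The formula is its own inverse, so it suffices that it maps each critical set into the other.
    -- Each passage goes through a dual pair, whose second prescribed rank is attained by
    -- genericity.
    · have hx := mem_dualPairs_of_mem_criticalPoints_AM' hr hs hU hY
      exact smul_mem_criticalPoints_AM hU hU0 hUne hx (hranks _ hx).1
  have hcard : ∀ U ∈ dataMatrices m, MvPolynomial.eval (upperEntries U) (f * g) ≠ 0 →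
      (criticalPoints U (AM m r)).encard = d := by
    intro U hU hne
    obtain ⟨hU0, hUne⟩ := hdata U hU (hsplit U hne).2
    obtain ⟨hd, hranks⟩ := hgen U (hsplit U hne).1
    have hc : totalSum U / 2 ≠ 0 := div_ne_zero hU0 two_ne_zero
    rw [← hd]
    -- The critical points on `AM m r` parametrize the dual pairs injectively, so the constant fibre
    -- cardinality `d` is the ML-degree.
    have himg : dualPairs U r s = (fun P => ((totalSum U / 2) • P, skewOnes m - dualPoint U P)) ''
        criticalPoints U (AM m r) := by
      ext ⟨P, R⟩
      constructor
      · intro hx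
        refine ⟨_, smul_mem_criticalPoints_AM hU hU0 hUne hx (hranks _ hx).1, ?_⟩
        have h1 : totalSum U / 2 * (2 / totalSum U) = 1 := by field_simp
        have h2 : dualPoint U ((2 / totalSum U) • P) = skewOnes m - R := by
          rw [dualPoint, entrywiseQuotient_smul, smul_smul,
            mul_inv_cancel₀ (div_ne_zero two_ne_zero hU0), one_smul,
            (entrywiseQuotient_of_mem_dualPairs hU hUne hx).1]
        simp only [smul_smul, h1, one_smul, h2, sub_sub_cancel]
      · rintro ⟨P', hP', h⟩
        rw [← h]
        exact mem_dualPairs_of_mem_criticalPoints_AM hs hU hU0 hP'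
    rw [himg]
    refine (Set.InjOn.encard_image fun P _ P' _ h => ?_).symm
    exact smul_right_injective _ hc (congrArg Prod.fst h)
  -- The entrywise product of `P` and its dual point does not depend on `P`, which makes both forms
  -- of the likelihood product constant.
  have hprod : ∀ U ∈ dataMatrices m, ∀ P ∈ criticalPoints U (AM m r), ∀ i j, i < j →
      P i j * dualPoint U P i j = ((2 / totalSum U) • U) i j := by
    intro U _ P hP i j hij
    have := hP.1.2.2.2 i j hij
    rw [dualPoint_apply, Matrix.smul_apply, smul_eq_mul, mul_left_comm, mul_div_cancel₀ _ this]
  refine ⟨forGeneralData_of_upperEntries hfg fun U hU hne => ⟨fun P hP Q => ?_, ?_,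
    hbij U hU hne, hinv U hU hne, fun u _ => ?_, ?_⟩, d,
    forGeneralData_of_upperEntries hfg hcard,
    forGeneralData_of_upperEntries hfg fun U hU hne => ?_⟩
  · exact hadamard_eq_iff_eq_entrywiseQuotient hU hP.1.1 hP.1.2.2.2 Q
  · exact (hdata U hU (hsplit U hne).2).1
  · exact ⟨_, fun P hP => likelihood_mul (hprod U hU P hP)⟩
  · exact ⟨_, fun P hP => likelihoodValues_mul hP.1.2.2.2 (hprod U hU P hP)⟩
  · have h := hbij U hU hne
    rw [← h.image_eq, h.injOn.encard_image, hcard U hU hne]
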